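/- Let $p$ be a prime and $m$ a natural number. For a pair $(X,Y)$ of $m\times m$-matrices over $\mathbb Z/p$ let $S_{X,Y}=(A_{X,Y}\subseteq B)$ be the following embedding of a subgroup in a finite $p^7$-bounded abelian group. $B$ is the direct sum of cyclic groups with generators $x_{1,j},x_{2,j},y_{1,j},y_{2,j},z_{1,j},z_{2,j}$ $(1\le j\le m)$ of orders $p^7,p^6,p^4,p^4,p^2,p^2$, respectively, and $A_{X,Y}$ is the subgroup generated, for $1\le j\le m$, by $$u_{1,j}=p^3x_{1,j}+py_{1,j}+py_{2,j}+z_{2,j},\qquad v_{1,j}=p^2y_{1,j}+pz_{1,j},\qquad v_{2,j}=p^2y_{2,j}+pz_{2,j},$$ $$u_{2,j}=p^2x_{2,j}+py_{2,j}+\sum_{i=1}^m X_{ij}\,(py_{1,i}+z_{1,i})+\sum_{i=1}^m Y_{ij}\,(py_{2,i}+z_{2,i}),$$ where the entries of $X$ and $Y$ are represented by integers (the choice does not affect $A_{X,Y}$). For a subgroup $A$ of a finite abelian group $B$ let $G(A\subseteq B)$ be the semidirect product $(A\oplus B)\rtimes_\psi D$, where $D$ is the cyclic group $\mathbb Z/e$,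 with $e$ the exponent of $A$, and $\psi(d)(a,b)=(a,b+da)$. A group is called metabelian if its commutator subgroup is contained in its center, and indecomposable if it is nontrivial and not the direct product of two nontrivial subgroups. Let $(X,Y)$ and $(X',Y')$ be two pairs of $m\times m$-matrices over $\mathbb Z/p$. 1. The group $G(S_{X,Y})$ is metabelian. If $m\ge 1$ and $(X,Y)$ is not equivalent under simultaneous conjugation to a pair of proper block diagonal matrices of the same block type, then $G(S_{X,Y})$ is indecomposable. 2. The groups $G(S_{X,Y})$ and $G(S_{X',Y'})$ are isomorphic if and only if the pairs $(X,Y)$ and $(X',Y')$ are equivalent under simultaneous conjugation, that is, there is an invertible $m\times m$-matrix $P$ over $\mathbb Z/p$ with $PXP^{-1}=X'$ and $PYP^{-1}=Y'$. -/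

import Mathlib

/-! ### The group construction `G(A ⊆ B)` -/

/-- Multiplication of elements of `A` by elements of the cyclic group `ZMod e`, where `e` is the
exponent of `A`: the class of the integer `k` sends `a` to `k • a`. -/
noncomputable def expMul {B : Type*} [AddCommGroup B] (A : AddSubgroup B) :
    ZMod (AddMonoid.exponent A) →+ (A →+ A) :=
  ZMod.lift (AddMonoid.exponent A)
    ⟨zmultiplesHom (A →+ A) (AddMonoidHom.id A), by
      ext a
      simpa using congrArg Subtype.val (AddMonoid.exponent_nsmul_eq_zero (G := A) a)⟩

theorem expMul_intCast {B : Type*} [AddCommGroup B] (A : AddSubgroup B) (k : ℤ) (a : A) :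
    expMul A (k : ZMod (AddMonoid.exponent A)) a = k • a := by
  simp [expMul]

/-- The automorphism `ψ(d) : (a, b) ↦ (a, b + d a)` of `A ⊕ B`. -/
noncomputable def shear {B : Type*} [AddCommGroup B] (A : AddSubgroup B) (d : ZMod (AddMonoid.exponent A)) :
    A × B ≃+ A × B where
  toFun w := (w.1, w.2 + (expMul A d w.1 : B))
  invFun w := (w.1, w.2 - (expMul A d w.1 : B))
  left_inv w := by simp
  right_inv w := by simp
  map_add' w w' := by
    ext
    · simp
    · simp only [Prod.snd_add, Prod.fst_add, map_add, AddSubgroup.coe_add]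
      abel

/-- The action `ψ` of `D = ZMod e` (`e` the exponent of `A`) on `A ⊕ B`, all groups being
written multiplicatively. -/
noncomputable def shearHom {B : Type*} [AddCommGroup B] (A : AddSubgroup B) :
    Multiplicative (ZMod (AddMonoid.exponent A)) →* MulAut (Multiplicative (A × B)) where
  toFun d := AddEquiv.toMultiplicative (shear A d.toAdd)
  map_one' := by
    ext w <;> simp [shear]
  map_mul' d d' := by
    ext w
    · simp [shear]
    · simp [shear]
      abel

/-- The group `G(A ⊆ B) = (A ⊕ B) ⋊ D`, with `D` cyclic of order the exponent of `A`. -/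
abbrev MetabelianGroup {B : Type*} [AddCommGroup B] (A : AddSubgroup B) : Type _ :=
  Multiplicative (A × B) ⋊[shearHom A] Multiplicative (ZMod (AddMonoid.exponent A))

/-- Metabelian in the sense that the commutator subgroup lies in the center. -/
def IsMetabelian (G : Type*) [Group G] : Prop :=
  commutator G ≤ Subgroup.center G

/-- A group is indecomposable if it is nontrivial and is not the (internal) direct product of two
nontrivial subgroups. -/
def IsIndecomposableGroup (G : Type*) [Group G] : Prop :=
  Nontrivial G ∧ ∀ H K : Subgroup G, H.Normal → K.Normal → IsCompl H K → H = ⊥ ∨ K = ⊥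

/-! ### The subgroup embedding `S_{X,Y} = (A ⊆ B)` -/

namespace RS

/-- The group `B`: a direct sum of cyclic groups with generators `x₁ⱼ, x₂ⱼ, y₁ⱼ, y₂ⱼ, z₁ⱼ, z₂ⱼ`
of orders `p^7, p^6, p^4, p^4, p^2, p^2`, one of each kind for each `j < m`. -/
abbrev Ambient (p m : ℕ) : Type :=
  (Fin m → ZMod (p ^ 7)) × (Fin m → ZMod (p ^ 6)) × (Fin m → ZMod (p ^ 4)) ×
    (Fin m → ZMod (p ^ 4)) × (Fin m → ZMod (p ^ 2)) × (Fin m → ZMod (p ^ 2))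

variable {p m : ℕ}

def x₁ (j : Fin m) : Ambient p m := (Pi.single j 1, 0, 0, 0, 0, 0)
def x₂ (j : Fin m) : Ambient p m := (0, Pi.single j 1, 0, 0, 0, 0)
def y₁ (j : Fin m) : Ambient p m := (0, 0, Pi.single j 1, 0, 0, 0)
def y₂ (j : Fin m) : Ambient p m := (0, 0, 0, Pi.single j 1, 0, 0)
def z₁ (j : Fin m) : Ambient p m := (0, 0, 0, 0, Pi.single j 1, 0)
def z₂ (j : Fin m) : Ambient p m := (0, 0, 0, 0, 0, Pi.single j 1)

def u₁ (j : Fin m) : Ambient p m :=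
  p ^ 3 • x₁ j + p • y₁ j + p • y₂ j + z₂ j

/-- The entries of `X` and `Y` are represented by integers in `[0, p)`. Another choice of
representatives changes `u₂` only by a combination of the elements `v₁` and `v₂` below. -/
def u₂ (X Y : Matrix (Fin m) (Fin m) (ZMod p)) (j : Fin m) : Ambient p m :=
  p ^ 2 • x₂ j + p • y₂ j
    + ∑ i, (X i j).val • (p • y₁ i + z₁ i)
    + ∑ i, (Y i j).val • (p • y₂ i + z₂ i)

def v₁ (j : Fin m) : Ambient p m := p ^ 2 • y₁ j + p • z₁ j
def v₂ (j : Fin m) : Ambient p m := p ^ 2 • y₂ j + p • z₂ j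

/-- The subgroup `A` of `B`, so that `S_{X,Y} = (A ⊆ B)`. -/
def S (X Y : Matrix (Fin m) (Fin m) (ZMod p)) : AddSubgroup (Ambient p m) :=
  AddSubgroup.closure
    (Set.range u₁ ∪ Set.range (u₂ X Y) ∪ Set.range v₁ ∪ Set.range v₂)

end RS

/-! ### Pairs of matrices -/

/-- Simultaneous conjugacy of two pairs of square matrices. -/
def SimConj {k : Type*} [Field k] {m : ℕ} (X Y X' Y' : Matrix (Fin m) (Fin m) k) : Prop :=
  ∃ P : GL (Fin m) k,
    (P : Matrix (Fin m) (Fin m) k) * X * ((P⁻¹ : GL (Fin m) k) : Matrix (Fin m) (Fin m) k) = X' ∧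
    (P : Matrix (Fin m) (Fin m) k) * Y * ((P⁻¹ : GL (Fin m) k) : Matrix (Fin m) (Fin m) k) = Y'

/-- `Z` is block diagonal with diagonal blocks of sizes `r` and `m - r`. -/
def IsBlockDiagAt {k : Type*} [Field k] {m : ℕ} (r : ℕ) (Z : Matrix (Fin m) (Fin m) k) : Prop :=
  ∀ i j : Fin m, ((i : ℕ) < r ∧ r ≤ (j : ℕ)) ∨ (r ≤ (i : ℕ) ∧ (j : ℕ) < r) → Z i j = 0

/-- The pair `(X, Y)` is simultaneously conjugate to a pair of proper block diagonal matrices of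
the same block type (more than two blocks can be grouped into two). -/
def IsDecomposablePair {k : Type*} [Field k] {m : ℕ} (X Y : Matrix (Fin m) (Fin m) k) : Prop :=
  ∃ (r : ℕ) (X' Y' : Matrix (Fin m) (Fin m) k), 0 < r ∧ r < m ∧
    IsBlockDiagAt r X' ∧ IsBlockDiagAt r Y' ∧ SimConj X Y X' Y'

/-!
The center of `G(A ⊆ B)` is `B` and the commutator subgroup is `A`, so the group determines the
embedding `A ⊆ B`, functorially with respect to the homomorphisms that map center to center
(`exists_addMonoidHom_of_map_center`). Isomorphisms of groups restrict to isomorphisms of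
embeddings, and conversely isomorphic embeddings have isomorphic groups. A direct decomposition
`G = H × K` yields an idempotent endomorphism of the embedding; if this endomorphism is zero or
the identity, one of the factors contains the center, and then the other factor is trivial
(`isIndecomposableGroup_metabelianGroup`).

The remaining question concerns endomorphisms `f` of the ambient group `B` which map the subgroup
of `(X, Y)` to the subgroup of `(X', Y')`. Modulo `p`, such an `f` acts on the generators `x₁` by a
matrix `P`, and `P` is multiplicative in `f`, since `x₁` has the largest order
(`RS.topMatrix_comp`). Reading the condition that `f` maps `u₁, u₂, v₁, v₂` to the subgroup
coordinate by coordinate, each coordinate multiplied by the power of `p` that kills the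
contributions of smaller order, one finds that all diagonal blocks of `f` are equal to `P` modulo
`p`, that the off-diagonal blocks between `y₁` and `y₂` and between `z₁` and `z₂` vanish, and that
`P X = X' P` and `P Y = Y' P` (`RS.morphism_constraints`).

Hence an isomorphism gives a simultaneous conjugation. For the converse, an invertible `P` lifts to
an invertible matrix over `ZMod (p ^ 7)`, and this acts on `B` and maps one subgroup onto the
other: the errors of the intertwining relations, which hold only modulo `p`, are combinations
of `v₁` and `v₂` (`RS.act_mem_S`). An idempotent `f` gives an idempotent `P` that commutes with `X`
and `Y`. If `P` is neither zero nor one, it decomposes the pair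
(`isDecomposablePair_of_idempotent`). If `P = 0`, then `f` is strictly triangular modulo `p` for
the order of the generators, hence `f = f ^ 4` maps into `p B`, and `f = f ^ 7` is zero
(`RS.eq_zero_of_topMatrix_eq_zero`); for `P = 1` the same applies to `1 - f`.
-/

/-! ### The center and the commutator subgroup of `G(A ⊆ B)` -/

section GroupConstruction

variable {B B' : Type*} [AddCommGroup B] [AddCommGroup B']

/-- The inclusion `b ↦ (0, b; 0)` of `B` in `G(A ⊆ B)`; its image is the center. -/
noncomputable def centralIncl (A : AddSubgroup B) : Multiplicative B →* MetabelianGroup A :=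
  SemidirectProduct.inl.comp (AddMonoidHom.toMultiplicative (AddMonoidHom.inr A B))

theorem centralIncl_injective (A : AddSubgroup B) : Function.Injective (centralIncl A) := by
  intro b b' h
  have h1 := SemidirectProduct.inl_injective h
  exact Multiplicative.toAdd.injective (congrArg (fun w => (Multiplicative.toAdd w).2) h1)

theorem eq_zero_of_expMul_eq_zero (A : AddSubgroup B) (d : ZMod (AddMonoid.exponent A))
    (h : ∀ a, expMul A d a = 0) : d = 0 := by
  obtain ⟨k, rfl⟩ := ZMod.intCast_surjective d
  rw [ZMod.intCast_zmod_eq_zero_iff_dvd, Int.natCast_dvd,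
    AddMonoid.exponent_dvd_iff_forall_nsmul_eq_zero]
  intro a
  have h1 := h a
  rw [expMul_intCast] at h1
  rcases Int.natAbs_eq k with hk | hk <;> rw [hk] at h1 <;> simpa using h1

namespace MetabelianGroup

/-- The element `(a, b; d)` of `G(A ⊆ B)`. -/
def mk (A : AddSubgroup B) (a : A) (b : B) (d : ZMod (AddMonoid.exponent A)) :
    MetabelianGroup A :=
  ⟨Multiplicative.ofAdd (a, b), Multiplicative.ofAdd d⟩

theorem exists_mk {A : AddSubgroup B} (g : MetabelianGroup A) : ∃ a b d, mk A a b d = g :=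
  ⟨(Multiplicative.toAdd g.left).1, (Multiplicative.toAdd g.left).2,
    Multiplicative.toAdd g.right, rfl⟩

theorem mk_mul_mk {A : AddSubgroup B} (a a' : A) (b b' : B)
    (d d' : ZMod (AddMonoid.exponent A)) :
    mk A a b d * mk A a' b' d' = mk A (a + a') (b + (b' + (expMul A d a' : A))) (d + d') :=
  rfl

theorem mk_inj {A : AddSubgroup B} {a a' : A} {b b' : B} {d d' : ZMod (AddMonoid.exponent A)} :
    mk A a b d = mk A a' b' d' ↔ a = a' ∧ b = b' ∧ d = d' := by
  constructor
  · intro h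
    have h1 : (a, b) = (a', b') := congrArg (fun g : MetabelianGroup A =>
      Multiplicative.toAdd g.left) h
    have h2 : d = d' := congrArg (fun g : MetabelianGroup A => Multiplicative.toAdd g.right) h
    exact ⟨congrArg Prod.fst h1, congrArg Prod.snd h1, h2⟩
  · rintro ⟨rfl, rfl, rfl⟩
    rfl

end MetabelianGroup

open MetabelianGroup

theorem centralIncl_eq_mk (A : AddSubgroup B) (b : B) :
    centralIncl A (Multiplicative.ofAdd b) = mk A 0 b 0 :=
  rfl

theorem mem_center_metabelianGroup {A : AddSubgroup B} {g : MetabelianGroup A} :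
    g ∈ Subgroup.center (MetabelianGroup A) ↔ ∃ b, centralIncl A (Multiplicative.ofAdd b) = g := by
  rw [Subgroup.mem_center_iff]
  constructor
  · obtain ⟨a, b, d, rfl⟩ := exists_mk g
    intro h
    have ha : a = 0 := by
      have h1 := h (mk A 0 0 ((1 : ℤ) : ZMod _))
      rw [mk_mul_mk, mk_mul_mk, mk_inj] at h1
      replace h1 := h1.2.1
      rw [expMul_intCast, map_zero] at h1
      simpa using h1
    have hd : d = 0 := by
      apply eq_zero_of_expMul_eq_zero
      intro a'
      have h1 := h (mk A a' 0 0)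
      rw [mk_mul_mk, mk_mul_mk, mk_inj] at h1
      replace h1 := h1.2.1
      rw [map_zero] at h1
      simpa using h1
    exact ⟨b, by rw [ha, hd, centralIncl_eq_mk]⟩
  · rintro ⟨b, rfl⟩ g
    obtain ⟨a', b', d', rfl⟩ := exists_mk g
    rw [centralIncl_eq_mk, mk_mul_mk, mk_mul_mk, map_zero, map_zero, mk_inj]
    simp [add_comm]

theorem mem_commutator_metabelianGroup {A : AddSubgroup B} {g : MetabelianGroup A} :
    g ∈ commutator (MetabelianGroup A) ↔
      ∃ a ∈ A, centralIncl A (Multiplicative.ofAdd a) = g := by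
  constructor
  · have h : commutator (MetabelianGroup A) ≤
        (AddSubgroup.toSubgroup A).map (centralIncl A) := by
      rw [commutator_def, Subgroup.commutator_le]
      intro g _ h _
      obtain ⟨a, b, d, rfl⟩ := exists_mk g
      obtain ⟨a', b', d', rfl⟩ := exists_mk h
      refine ⟨Multiplicative.ofAdd ((expMul A d a' - expMul A d' a : A) : B),
        (expMul A d a' - expMul A d' a).2, ?_⟩
      rw [commutatorElement_def, eq_mul_inv_iff_mul_eq, eq_mul_inv_iff_mul_eq, centralIncl_eq_mk,
        mk_mul_mk, mk_mul_mk, mk_mul_mk, map_zero, mk_inj]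
      refine ⟨by abel, ?_, by abel⟩
      simp only [AddMonoidHom.zero_apply, AddSubgroup.coe_zero, AddSubgroup.coe_sub, zero_add,
        add_zero]
      abel
    intro hg
    obtain ⟨a, ha, rfl⟩ := h hg
    exact ⟨Multiplicative.toAdd a, ha, rfl⟩
  · rintro ⟨a, ha, rfl⟩
    have h : mk A 0 0 ((1 : ℤ) : ZMod _) * mk A ⟨a, ha⟩ 0 0 *
        (mk A 0 0 ((1 : ℤ) : ZMod _))⁻¹ * (mk A ⟨a, ha⟩ 0 0)⁻¹ =
        centralIncl A (Multiplicative.ofAdd a) := by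
      rw [mul_inv_eq_iff_eq_mul, mul_inv_eq_iff_eq_mul, centralIncl_eq_mk,
        mk_mul_mk, mk_mul_mk, mk_mul_mk, expMul_intCast, map_zero, mk_inj]
      simp
    rw [← h]
    exact Subgroup.commutator_mem_commutator (Subgroup.mem_top _) (Subgroup.mem_top _)

theorem isMetabelian_metabelianGroup (A : AddSubgroup B) : IsMetabelian (MetabelianGroup A) := by
  intro g hg
  obtain ⟨a, -, h⟩ := mem_commutator_metabelianGroup.1 hg
  exact mem_center_metabelianGroup.2 ⟨a, h⟩

/-- A homomorphism of groups that respects the centers restricts to a morphism of the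
embeddings `A ⊆ B`, because these are the embeddings of the commutator subgroups in the centers. -/
theorem exists_addMonoidHom_of_map_center {A : AddSubgroup B} {A' : AddSubgroup B'}
    (Φ : MetabelianGroup A →* MetabelianGroup A')
    (hΦ : ∀ g ∈ Subgroup.center (MetabelianGroup A), Φ g ∈ Subgroup.center (MetabelianGroup A')) :
    ∃ f : B →+ B', (∀ b, Φ (centralIncl A (Multiplicative.ofAdd b)) =
      centralIncl A' (Multiplicative.ofAdd (f b))) ∧ ∀ a ∈ A, f a ∈ A' := by
  have h1 : ∀ b, ∃ b', centralIncl A' (Multiplicative.ofAdd b') =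
      Φ (centralIncl A (Multiplicative.ofAdd b)) := fun b =>
    mem_center_metabelianGroup.1 (hΦ _ (mem_center_metabelianGroup.2 ⟨b, rfl⟩))
  choose f hf using h1
  refine ⟨AddMonoidHom.mk' f fun b b' => ?_, fun b => (hf b).symm, fun a ha => ?_⟩
  · apply Multiplicative.ofAdd.injective
    apply centralIncl_injective A'
    rw [hf, ofAdd_add, ofAdd_add, map_mul, map_mul, map_mul, hf, hf]
  · have h2 : Φ (centralIncl A (Multiplicative.ofAdd a)) ∈ commutator (MetabelianGroup A') := by
      have h3 := Subgroup.mem_map_of_mem Φ (mem_commutator_metabelianGroup.2 ⟨a, ha, rfl⟩)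
      rw [commutator_def, Subgroup.map_commutator] at h3
      exact Subgroup.commutator_mono le_top le_top h3
    obtain ⟨a', ha', h⟩ := mem_commutator_metabelianGroup.1 h2
    rw [← hf] at h
    have h4 : a' = f a := Multiplicative.ofAdd.injective (centralIncl_injective A' h)
    rwa [h4] at ha'

theorem mem_center_of_mulEquiv {G G' : Type*} [Group G] [Group G'] (e : G ≃* G') {g : G}
    (hg : g ∈ Subgroup.center G) : e g ∈ Subgroup.center G' := by
  rw [Subgroup.mem_center_iff] at hg ⊢
  intro x
  obtain ⟨y, rfl⟩ := e.surjective x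
  rw [← map_mul, hg, map_mul]

/-- An isomorphism of groups restricts to an isomorphism of embeddings. -/
theorem exists_addMonoidHom_of_mulEquiv {A : AddSubgroup B} {A' : AddSubgroup B'}
    (e : MetabelianGroup A ≃* MetabelianGroup A') :
    ∃ (f : B →+ B') (f' : B' →+ B), (∀ b, f' (f b) = b) ∧ (∀ b, f (f' b) = b) ∧
      (∀ a ∈ A, f a ∈ A') ∧ ∀ a ∈ A', f' a ∈ A := by
  obtain ⟨f, hf, hA⟩ := exists_addMonoidHom_of_map_center e.toMonoidHom
    fun g hg => mem_center_of_mulEquiv e hg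
  obtain ⟨f', hf', hA'⟩ := exists_addMonoidHom_of_map_center e.symm.toMonoidHom
    fun g hg => mem_center_of_mulEquiv e.symm hg
  refine ⟨f, f', fun b => ?_, fun b => ?_, hA, hA'⟩
  · apply Multiplicative.ofAdd.injective
    apply centralIncl_injective A
    rw [← hf', ← hf]
    simp
  · apply Multiplicative.ofAdd.injective
    apply centralIncl_injective A'
    rw [← hf, ← hf']
    simp

/-- Isomorphic embeddings have isomorphic groups. -/
theorem nonempty_mulEquiv_of_addEquiv {A : AddSubgroup B} {A' : AddSubgroup B'} (f : B ≃+ B')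
    (hf : ∀ a ∈ A, f a ∈ A') (hf' : ∀ a ∈ A', f.symm a ∈ A) :
    Nonempty (MetabelianGroup A ≃* MetabelianGroup A') := by
  let fA : A ≃+ A' :=
    { toFun := fun a => ⟨f a, hf a a.2⟩
      invFun := fun a => ⟨f.symm a, hf' a a.2⟩
      left_inv := fun a => by simp
      right_inv := fun a => by simp
      map_add' := fun a b => by ext; simp }
  have he : AddMonoid.exponent A = AddMonoid.exponent A' :=
    AddMonoid.exponent_eq_of_addEquiv fA
  refine ⟨SemidirectProduct.congr (AddEquiv.toMultiplicative (fA.prodCongr f))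
    (AddEquiv.toMultiplicative (ZMod.ringEquivCongr he).toAddEquiv) fun d => ?_⟩
  obtain ⟨k, hk⟩ := ZMod.intCast_surjective (Multiplicative.toAdd d)
  apply MulEquiv.ext
  intro w
  have h1 : expMul A' (ZMod.ringEquivCongr he (Multiplicative.toAdd d))
      (fA (Multiplicative.toAdd w).1) = fA (expMul A (Multiplicative.toAdd d)
        (Multiplicative.toAdd w).1) := by
    rw [← hk, ZMod.ringEquivCongr_intCast, expMul_intCast, expMul_intCast, map_zsmul]
  apply Multiplicative.toAdd.injective
  refine Prod.ext rfl ?_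
  change f ((Multiplicative.toAdd w).2 + ((expMul A (Multiplicative.toAdd d)
      (Multiplicative.toAdd w).1 : A) : B)) = f (Multiplicative.toAdd w).2 +
    ((expMul A' (ZMod.ringEquivCongr he (Multiplicative.toAdd d))
      (fA (Multiplicative.toAdd w).1) : A') : B')
  rw [h1, map_add]
  rfl

/-! ### Direct decompositions -/

/-- For an internal direct product `G = H × K`, there is the projection of `G` onto `H`. -/
theorem exists_projection_of_isCompl {G : Type*} [Group G] {H K : Subgroup G}
    (hH : H.Normal) (hK : K.Normal) (h : IsCompl H K) :
    ∃ e : G →* G, (∀ g, e g ∈ H) ∧ (∀ g ∈ H, e g = g) ∧ ∀ g, e g = 1 ↔ g ∈ K := by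
  have hc : ∀ (x : H) (y : K), Commute (H.subtype x) (K.subtype y) := fun x y =>
    Subgroup.commute_of_normal_of_disjoint H K hH hK h.disjoint x y x.2 y.2
  let φ := H.subtype.noncommCoprod K.subtype hc
  have hinj : Function.Injective φ := by
    rw [MonoidHom.noncommCoprod_injective]
    refine ⟨H.subtype_injective, K.subtype_injective, ?_⟩
    simpa using h.disjoint
  have hsurj : Function.Surjective φ := by
    rw [← MonoidHom.range_eq_top, MonoidHom.noncommCoprod_range]
    simpa using h.sup_eq_top
  let ψ := MulEquiv.ofBijective φ ⟨hinj, hsurj⟩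
  have hψ : ∀ x : H × K, ψ x = x.1 * x.2 := fun x => rfl
  refine ⟨(H.subtype.comp (MonoidHom.fst H K)).comp ψ.symm.toMonoidHom, ?_, ?_, ?_⟩
  · intro g
    exact SetLike.coe_mem _
  · intro g hg
    have : ψ.symm g = (⟨g, hg⟩, 1) := by
      rw [MulEquiv.symm_apply_eq, hψ]; simp
    simp [this]
  · intro g
    obtain ⟨x, rfl⟩ := ψ.surjective g
    have h1 : (x.1 : G) * x.2 ∈ K ↔ (x.1 : G) ∈ K := Subgroup.mul_mem_cancel_right K x.2.2
    rw [hψ, h1]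
    simp only [MulEquiv.toMonoidHom_eq_coe, MonoidHom.comp_apply, MonoidHom.coe_coe, ← hψ,
      MulEquiv.symm_apply_apply, MonoidHom.coe_fst, Subgroup.coe_subtype]
    constructor
    · intro h2; rw [h2]; exact one_mem _
    · intro h2
      have h3 : (x.1 : G) ∈ H ⊓ K := ⟨x.1.2, h2⟩
      simpa [h.inf_eq_bot] using h3

/-- If the second factor of `G = H × K` contains the center and `G` is metabelian, then `H` is
trivial: `H` is abelian, since its commutators are central, and so it is itself central. -/
theorem eq_bot_of_center_le {G : Type*} [Group G] (hG : IsMetabelian G) {H K : Subgroup G}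
    (hH : H.Normal) (hK : K.Normal) (h : IsCompl H K) (hZ : Subgroup.center G ≤ K) : H = ⊥ := by
  have hdis : ∀ g, g ∈ H → g ∈ K → g = 1 := fun g h1 h2 => by
    have h3 : g ∈ H ⊓ K := ⟨h1, h2⟩
    simpa [h.inf_eq_bot] using h3
  rw [Subgroup.eq_bot_iff_forall]
  intro x hx
  refine hdis x hx (hZ ?_)
  have h1 : H ≤ Subgroup.centralizer {x} := by
    intro y hy
    rw [Subgroup.mem_centralizer_singleton_iff]
    have h2 : y * x * y⁻¹ * x⁻¹ = 1 :=
      hdis _ (H.mul_mem (H.mul_mem (H.mul_mem hy hx) (H.inv_mem hy)) (H.inv_mem hx))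
        (hZ (hG (Subgroup.commutator_mem_commutator (Subgroup.mem_top y) (Subgroup.mem_top x))))
    rwa [mul_inv_eq_one, mul_inv_eq_iff_eq_mul] at h2
  have h2 : K ≤ Subgroup.centralizer {x} := by
    intro y hy
    rw [Subgroup.mem_centralizer_singleton_iff]
    exact (Subgroup.commute_of_normal_of_disjoint H K hH hK h.disjoint x y hx hy).symm
  have h3 : Subgroup.centralizer {x} = ⊤ := top_le_iff.1 (h.sup_eq_top ▸ sup_le h1 h2)
  rw [Subgroup.mem_center_iff]
  intro y
  have h4 : y ∈ Subgroup.centralizer {x} := h3 ▸ Subgroup.mem_top y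
  rwa [Subgroup.mem_centralizer_singleton_iff] at h4

/-- `G(A ⊆ B)` is indecomposable if the only idempotent endomorphisms of the embedding `A ⊆ B`
are zero and the identity. -/
theorem isIndecomposableGroup_metabelianGroup [Nontrivial B] (A : AddSubgroup B)
    (hA : ∀ f : B →+ B, (∀ a ∈ A, f a ∈ A) → (∀ b, f (f b) = f b) →
      (∀ b, f b = 0) ∨ ∀ b, f b = b) :
    IsIndecomposableGroup (MetabelianGroup A) := by
  refine ⟨(centralIncl_injective A).nontrivial, fun H K hH hK h => ?_⟩
  obtain ⟨e, he1, he2, he3⟩ := exists_projection_of_isCompl hH hK h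
  obtain ⟨f, hf, hfA⟩ := exists_addMonoidHom_of_map_center e (by
    intro g hg
    rw [Subgroup.mem_center_iff] at hg ⊢
    -- `x = e x * y` with `y ∈ K`, and `y` commutes with `e g ∈ H`.
    intro x
    have hy : (e x)⁻¹ * x ∈ K := by
      rw [← he3, map_mul, map_inv, he2 _ (he1 x), inv_mul_cancel]
    have h1 := (Subgroup.commute_of_normal_of_disjoint H K hH hK h.disjoint _ _ (he1 g) hy).eq
    have h2 : e x * e g = e g * e x := by rw [← map_mul, hg, map_mul]
    calc x * e g = e x * ((e x)⁻¹ * x * e g) := by group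
      _ = e x * e g * ((e x)⁻¹ * x) := by rw [← h1, mul_assoc]
      _ = e g * x := by rw [h2]; group)
  have hff : ∀ b, f (f b) = f b := fun b => by
    apply Multiplicative.ofAdd.injective
    apply centralIncl_injective A
    rw [← hf, ← hf, he2 _ (he1 _)]
  rcases hA f hfA hff with h0 | h0
  · left
    refine eq_bot_of_center_le (isMetabelian_metabelianGroup A) hH hK h fun g hg => ?_
    obtain ⟨b, rfl⟩ := mem_center_metabelianGroup.1 hg
    rw [← he3, hf, h0, ofAdd_zero, map_one]
  · right
    refine eq_bot_of_center_le (isMetabelian_metabelianGroup A) hK hH h.symm fun g hg => ?_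
    obtain ⟨b, rfl⟩ := mem_center_metabelianGroup.1 hg
    have h1 := hf b
    rw [h0] at h1
    exact h1 ▸ he1 _

end GroupConstruction

/-! ### Reduction of coordinates modulo `p` -/

namespace RS

section Reduction

variable {p m : ℕ}

/-- Coordinatewise reduction of vectors over `ZMod (p ^ (n + 1))` modulo `p`. -/
def redVec (p m n : ℕ) : (Fin m → ZMod (p ^ (n + 1))) →+ (Fin m → ZMod p) :=
  (ZMod.castHom (dvd_pow_self p n.succ_ne_zero) (ZMod p)).toAddMonoidHom.compLeft (Fin m)

theorem redVec_apply {n : ℕ} (v : Fin m → ZMod (p ^ (n + 1))) (i : Fin m) :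
    redVec p m n v i = ZMod.castHom (dvd_pow_self p n.succ_ne_zero) (ZMod p) (v i) :=
  rfl

theorem natCast_pow_eq_zero (n : ℕ) : (p : ZMod (p ^ n)) ^ n = 0 := by
  rw [← Nat.cast_pow, ZMod.natCast_self]

/-- The `x₁`-coordinates of an element of the ambient group, modulo `p`. -/
def redX₁ : Ambient p m →+ (Fin m → ZMod p) := (redVec p m 6).comp (AddMonoidHom.fst _ _)

/-- The `x₂`-coordinates of an element of the ambient group, modulo `p`. -/
def redX₂ : Ambient p m →+ (Fin m → ZMod p) :=
  (redVec p m 5).comp ((AddMonoidHom.fst _ _).comp (AddMonoidHom.snd _ _))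

/-- The `y₁`-coordinates of an element of the ambient group, modulo `p`. -/
def redY₁ : Ambient p m →+ (Fin m → ZMod p) :=
  (redVec p m 3).comp ((AddMonoidHom.fst _ _).comp
    ((AddMonoidHom.snd _ _).comp (AddMonoidHom.snd _ _)))

/-- The `y₂`-coordinates of an element of the ambient group, modulo `p`. -/
def redY₂ : Ambient p m →+ (Fin m → ZMod p) :=
  (redVec p m 3).comp ((AddMonoidHom.fst _ _).comp
    ((AddMonoidHom.snd _ _).comp ((AddMonoidHom.snd _ _).comp (AddMonoidHom.snd _ _))))

/-- The `z₁`-coordinates of an element of the ambient group, modulo `p`. -/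
def redZ₁ : Ambient p m →+ (Fin m → ZMod p) :=
  (redVec p m 1).comp ((AddMonoidHom.fst _ _).comp
    ((AddMonoidHom.snd _ _).comp ((AddMonoidHom.snd _ _).comp
      ((AddMonoidHom.snd _ _).comp (AddMonoidHom.snd _ _)))))

/-- The `z₂`-coordinates of an element of the ambient group, modulo `p`. -/
def redZ₂ : Ambient p m →+ (Fin m → ZMod p) :=
  (redVec p m 1).comp ((AddMonoidHom.snd _ _).comp
    ((AddMonoidHom.snd _ _).comp ((AddMonoidHom.snd _ _).comp
      ((AddMonoidHom.snd _ _).comp (AddMonoidHom.snd _ _)))))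

theorem redX₁_eq (b : Ambient p m) : redX₁ b = redVec p m 6 b.1 := rfl
theorem redX₂_eq (b : Ambient p m) : redX₂ b = redVec p m 5 b.2.1 := rfl
theorem redY₁_eq (b : Ambient p m) : redY₁ b = redVec p m 3 b.2.2.1 := rfl
theorem redY₂_eq (b : Ambient p m) : redY₂ b = redVec p m 3 b.2.2.2.1 := rfl
theorem redZ₁_eq (b : Ambient p m) : redZ₁ b = redVec p m 1 b.2.2.2.2.1 := rfl
theorem redZ₂_eq (b : Ambient p m) : redZ₂ b = redVec p m 1 b.2.2.2.2.2 := rfl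

theorem pow_smul_x₂ (j : Fin m) : p ^ 6 • (x₂ j : Ambient p m) = 0 := by
  ext i <;> simp [x₂, natCast_pow_eq_zero]
theorem pow_smul_y₁ (j : Fin m) : p ^ 4 • (y₁ j : Ambient p m) = 0 := by
  ext i <;> simp [y₁, natCast_pow_eq_zero]
theorem pow_smul_y₂ (j : Fin m) : p ^ 4 • (y₂ j : Ambient p m) = 0 := by
  ext i <;> simp [y₂, natCast_pow_eq_zero]
theorem pow_smul_z₁ (j : Fin m) : p ^ 2 • (z₁ j : Ambient p m) = 0 := by
  ext i <;> simp [z₁, natCast_pow_eq_zero]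
theorem pow_smul_z₂ (j : Fin m) : p ^ 2 • (z₂ j : Ambient p m) = 0 := by
  ext i <;> simp [z₂, natCast_pow_eq_zero]

theorem pow_smul_eq_zero_of_le {M : Type*} [AddCommGroup M] {k l : ℕ} (h : k ≤ l) {b : M}
    (hb : p ^ k • b = 0) : p ^ l • b = 0 := by
  obtain ⟨d, rfl⟩ := Nat.exists_eq_add_of_le' h
  rw [pow_add, mul_smul, hb, smul_zero]

theorem pow_smul_map {M N : Type*} [AddCommGroup M] [AddCommGroup N] (f : M →+ N) {k : ℕ} {b : M}
    (h : p ^ k • b = 0) : p ^ k • f b = 0 := by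
  rw [← map_nsmul, h, map_zero]

variable [Fact p.Prime]

theorem natCast_ne_zero_int : (p : ℤ) ≠ 0 :=
  Nat.cast_ne_zero.2 (Fact.out : p.Prime).ne_zero

/-- Division of an integral congruence modulo `p ^ (n + k)` by `p ^ n`. -/
theorem dvd_of_pow_mul_intCast_eq_zero {n k : ℕ} {a : ℤ}
    (h : (p : ZMod (p ^ (n + k))) ^ n * (a : ZMod (p ^ (n + k))) = 0) : (p : ℤ) ^ k ∣ a := by
  have h1 : (((p : ℤ) ^ n * a : ℤ) : ZMod (p ^ (n + k))) = 0 := by push_cast; exact h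
  rw [ZMod.intCast_zmod_eq_zero_iff_dvd] at h1
  push_cast at h1
  rw [pow_add] at h1
  exact (mul_dvd_mul_iff_left (pow_ne_zero _ natCast_ne_zero_int)).1 h1

theorem castHom_eq_zero_of_pow_mul {n : ℕ} {a : ZMod (p ^ (n + 1))}
    (h : (p : ZMod (p ^ (n + 1))) ^ n * a = 0) :
    ZMod.castHom (dvd_pow_self p n.succ_ne_zero) (ZMod p) a = 0 := by
  obtain ⟨k, rfl⟩ := ZMod.intCast_surjective a
  have h1 := dvd_of_pow_mul_intCast_eq_zero h
  rw [pow_one] at h1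
  rw [map_intCast, ZMod.intCast_zmod_eq_zero_iff_dvd]
  exact h1

theorem redVec_apply_eq_intCast {n : ℕ} {v : Fin m → ZMod (p ^ (n + 1))} {i : Fin m} {k : ℤ}
    (h : (p : ZMod (p ^ (n + 1))) ^ n * (v i - k) = 0) : redVec p m n v i = k := by
  have h1 := castHom_eq_zero_of_pow_mul h
  rwa [map_sub, map_intCast, sub_eq_zero] at h1

theorem redVec_eq_zero {n : ℕ} {v : Fin m → ZMod (p ^ (n + 1))} (h : p ^ n • v = 0) :
    redVec p m n v = 0 := by
  ext i
  have h1 := congrFun h i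
  rw [Pi.smul_apply, nsmul_eq_mul, Nat.cast_pow] at h1
  exact castHom_eq_zero_of_pow_mul h1

theorem redX₁_eq_zero {b : Ambient p m} (h : p ^ 6 • b = 0) : redX₁ b = 0 :=
  redVec_eq_zero (congrArg (fun b => b.1) h)
theorem redX₂_eq_zero {b : Ambient p m} (h : p ^ 5 • b = 0) : redX₂ b = 0 :=
  redVec_eq_zero (congrArg (fun b => b.2.1) h)
theorem redY₁_eq_zero {b : Ambient p m} (h : p ^ 3 • b = 0) : redY₁ b = 0 :=
  redVec_eq_zero (congrArg (fun b => b.2.2.1) h)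
theorem redY₂_eq_zero {b : Ambient p m} (h : p ^ 3 • b = 0) : redY₂ b = 0 :=
  redVec_eq_zero (congrArg (fun b => b.2.2.2.1) h)

theorem val_smul_eq (c : ZMod p) (v : Fin m → ZMod p) : c.val • v = c • v := by
  rw [← Nat.cast_smul_eq_nsmul (ZMod p), ZMod.natCast_zmod_val]

theorem sum_val_smul_single {n : ℕ} [NeZero n] (v : Fin m → ZMod n) :
    ∑ j, (v j).val • (Pi.single j 1 : Fin m → ZMod n) = v := by
  ext i
  simp only [Finset.sum_apply, Pi.smul_apply]
  simp only [nsmul_eq_mul, ZMod.natCast_zmod_val,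
    Pi.single_apply, mul_ite, mul_one, mul_zero, Finset.sum_ite_eq, Finset.mem_univ, if_true]

/-- A homomorphism from the ambient group to an elementary abelian group is determined by its
values at the generators and the residues of the coordinates modulo `p`. -/
theorem map_eq_sum (φ : Ambient p m →+ (Fin m → ZMod p)) (b : Ambient p m) :
    φ b = ∑ j, (redX₁ b j • φ (x₁ j) + redX₂ b j • φ (x₂ j) + redY₁ b j • φ (y₁ j) +
      redY₂ b j • φ (y₂ j) + redZ₁ b j • φ (z₁ j) + redZ₂ b j • φ (z₂ j)) := by
  have hb : b = ∑ j, ((b.1 j).val • x₁ j + (b.2.1 j).val • x₂ j + (b.2.2.1 j).val • y₁ j +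
      (b.2.2.2.1 j).val • y₂ j + (b.2.2.2.2.1 j).val • z₁ j + (b.2.2.2.2.2 j).val • z₂ j) := by
    simp only [x₁, x₂, y₁, y₂, z₁, z₂, Prod.smul_mk, smul_zero, Prod.mk_add_mk, add_zero, zero_add]
    refine Prod.ext ?_ (Prod.ext ?_ (Prod.ext ?_ (Prod.ext ?_ (Prod.ext ?_ ?_)))) <;>
      simp only [Prod.fst_sum, Prod.snd_sum, sum_val_smul_single]
  have hval : ∀ {n : ℕ} (v : Fin m → ZMod (p ^ (n + 1))) (j : Fin m) (w : Fin m → ZMod p),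
      (v j).val • w = redVec p m n v j • w := by
    intro n v j w
    rw [← Nat.cast_smul_eq_nsmul (ZMod p), redVec_apply, ← map_natCast
      (ZMod.castHom (dvd_pow_self p n.succ_ne_zero) (ZMod p)), ZMod.natCast_zmod_val]
  conv_lhs => rw [hb]
  rw [map_sum]
  refine Finset.sum_congr rfl fun j _ => ?_
  simp only [map_add, map_nsmul, hval, redX₁_eq, redX₂_eq, redY₁_eq, redY₂_eq, redZ₁_eq, redZ₂_eq]

end Reduction

/-! ### Elements of the subgroup -/

section Subgroup

variable {p m : ℕ} [Fact p.Prime]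

/-- The coordinates of an integral combination of the generators `u₁, u₂, v₁, v₂`. -/
theorem exists_of_mem_S {X Y : Matrix (Fin m) (Fin m) (ZMod p)} {b : Ambient p m}
    (hb : b ∈ S X Y) : ∃ α β γ δ : Fin m → ℤ, ∀ i,
      b.1 i = p ^ 3 * α i ∧ b.2.1 i = p ^ 2 * β i ∧
      b.2.2.1 i = p * α i + p * (∑ j, (X i j).val * β j : ℤ) + p ^ 2 * γ i ∧
      b.2.2.2.1 i = p * α i + p * β i + p * (∑ j, (Y i j).val * β j : ℤ) + p ^ 2 * δ i ∧
      b.2.2.2.2.1 i = (∑ j, (X i j).val * β j : ℤ) + p * γ i ∧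
      b.2.2.2.2.2 i = α i + (∑ j, (Y i j).val * β j : ℤ) + p * δ i := by
  induction hb using AddSubgroup.closure_induction with
  | mem b hb =>
    rcases hb with ((⟨j, rfl⟩ | ⟨j, rfl⟩) | ⟨j, rfl⟩) | ⟨j, rfl⟩
    · refine ⟨Pi.single j 1, 0, 0, 0, fun i => ?_⟩
      by_cases h : i = j <;>
        simp [u₁, x₁, y₁, y₂, z₂, h]
    · refine ⟨0, Pi.single j 1, 0, 0, fun i => ?_⟩
      by_cases h : i = j <;>
        simp [-ZMod.natCast_val, u₂, x₂, y₁, y₂, z₁, z₂, h, Prod.fst_sum, Prod.snd_sum,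
          Pi.single_apply, mul_comm]
    · refine ⟨0, 0, Pi.single j 1, 0, fun i => ?_⟩
      by_cases h : i = j <;> simp [v₁, y₁, z₁, h]
    · refine ⟨0, 0, 0, Pi.single j 1, fun i => ?_⟩
      by_cases h : i = j <;> simp [v₂, y₂, z₂, h]
  | zero => exact ⟨0, 0, 0, 0, fun i => by simp⟩
  | add b c _ _ hb hc =>
    obtain ⟨α, β, γ, δ, h⟩ := hb
    obtain ⟨α', β', γ', δ', h'⟩ := hc
    refine ⟨α + α', β + β', γ + γ', δ + δ', fun i => ?_⟩
    obtain ⟨h1, h2, h3, h4, h5, h6⟩ := h i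
    obtain ⟨h1', h2', h3', h4', h5', h6'⟩ := h' i
    simp only [Prod.fst_add, Prod.snd_add, Pi.add_apply, mul_add, Finset.sum_add_distrib, h1, h2,
      h3, h4, h5, h6, h1', h2', h3', h4', h5', h6']
    push_cast
    refine ⟨?_, ?_, ?_, ?_, ?_, ?_⟩ <;> ring
  | neg b _ hb =>
    obtain ⟨α, β, γ, δ, h⟩ := hb
    refine ⟨-α, -β, -γ, -δ, fun i => ?_⟩
    obtain ⟨h1, h2, h3, h4, h5, h6⟩ := h i
    simp only [Prod.fst_neg, Prod.snd_neg, Pi.neg_apply, mul_neg, Finset.sum_neg_distrib, h1, h2,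
      h3, h4, h5, h6]
    push_cast
    refine ⟨?_, ?_, ?_, ?_, ?_, ?_⟩ <;> ring

theorem intCast_sum_val_mul (X : Matrix (Fin m) (Fin m) (ZMod p)) (β : Fin m → ℤ) (i : Fin m) :
    ((∑ j, (X i j).val * β j : ℤ) : ZMod p) = (X.mulVec fun j => (β j : ZMod p)) i := by
  simp [Matrix.mulVec, dotProduct]

/-- The constraints on an element of the shape of `u₁` or `u₂` to lie in the subgroup: `α` and `β`
are the residues of the coefficients at `u₁` and `u₂`, and the element has the shape of `u₁` when
`a` is divisible by `p`, in which case `α` is seen in the `x₁`-coordinates. Each constraint is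
obtained from a coordinate of the element by multiplication with the power of `p` that kills the
contributions of the generators of smaller order. -/
theorem exists_of_add_mem_S {X Y : Matrix (Fin m) (Fin m) (ZMod p)} {a g h : Ambient p m}
    (hg : p ^ 4 • g = 0) (hh : p ^ 2 • h = 0) (hmem : p ^ 2 • a + p • g + h ∈ S X Y) :
    ∃ α β : Fin m → ZMod p, (∀ a', a = p • a' → redX₁ a' = α) ∧ redX₂ a = β ∧
      redY₁ g = α + X.mulVec β ∧ redY₂ g = α + β + Y.mulVec β ∧
      redZ₁ h = X.mulVec β ∧ redZ₂ h = α + Y.mulVec β := by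
  obtain ⟨α, β, γ, δ, H⟩ := exists_of_mem_S hmem
  refine ⟨fun i => α i, fun i => β i, fun a' ha => ?_, ?_, ?_, ?_, ?_, ?_⟩
  · subst ha
    ext i
    rw [redX₁_eq]
    refine redVec_apply_eq_intCast ?_
    have h1 := (H i).1
    have h2 := congrFun (congrArg (fun b => b.1) hg) i
    have h3 := congrFun (congrArg (fun b => b.1) hh) i
    simp at h1 h2 h3
    linear_combination (p : ZMod (p ^ 7)) ^ 3 * h1 - h2 - p * h3
  · ext i
    rw [redX₂_eq]
    refine redVec_apply_eq_intCast ?_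
    have h1 := (H i).2.1
    have h2 := congrFun (congrArg (fun b => b.2.1) hg) i
    have h3 := congrFun (congrArg (fun b => b.2.1) hh) i
    simp at h1 h2 h3
    linear_combination (p : ZMod (p ^ 6)) ^ 3 * h1 - h2 - p * h3
  · ext i
    rw [Pi.add_apply, ← intCast_sum_val_mul, ← Int.cast_add]
    rw [redY₁_eq]
    refine redVec_apply_eq_intCast ?_
    have h1 := (H i).2.2.1
    have h3 := congrFun (congrArg (fun b => b.2.2.1) hh) i
    generalize (∑ j, ((X i j).val : ℤ) * β j) = s at h1 ⊢
    simp at h1 h3 ⊢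
    linear_combination (p : ZMod (p ^ 4)) ^ 2 * h1 - h3 +
      (γ i - a.2.2.1 i) * natCast_pow_eq_zero (p := p) 4
  · ext i
    rw [Pi.add_apply, Pi.add_apply, ← intCast_sum_val_mul, ← Int.cast_add, ← Int.cast_add]
    rw [redY₂_eq]
    refine redVec_apply_eq_intCast ?_
    have h1 := (H i).2.2.2.1
    have h3 := congrFun (congrArg (fun b => b.2.2.2.1) hh) i
    generalize (∑ j, ((Y i j).val : ℤ) * β j) = s at h1 ⊢
    simp at h1 h3 ⊢
    linear_combination (p : ZMod (p ^ 4)) ^ 2 * h1 - h3 +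
      (δ i - a.2.2.2.1 i) * natCast_pow_eq_zero (p := p) 4
  · ext i
    rw [← intCast_sum_val_mul]
    rw [redZ₁_eq]
    refine redVec_apply_eq_intCast ?_
    have h1 := (H i).2.2.2.2.1
    generalize (∑ j, ((X i j).val : ℤ) * β j) = s at h1 ⊢
    simp at h1 ⊢
    linear_combination (p : ZMod (p ^ 2)) * h1 +
      (γ i - p * a.2.2.2.2.1 i - g.2.2.2.2.1 i) * natCast_pow_eq_zero (p := p) 2
  · ext i
    rw [Pi.add_apply, ← intCast_sum_val_mul, ← Int.cast_add]
    rw [redZ₂_eq]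
    refine redVec_apply_eq_intCast ?_
    have h1 := (H i).2.2.2.2.2
    generalize (∑ j, ((Y i j).val : ℤ) * β j) = s at h1 ⊢
    simp at h1 ⊢
    linear_combination (p : ZMod (p ^ 2)) * h1 +
      (δ i - p * a.2.2.2.2.2 i - g.2.2.2.2.2 i) * natCast_pow_eq_zero (p := p) 2

/-- The constraints on an element of the shape of `v₁` or `v₂` to lie in the subgroup. -/
theorem red_eq_of_add_mem_S {X Y : Matrix (Fin m) (Fin m) (ZMod p)} {g h : Ambient p m}
    (hg : p ^ 4 • g = 0) (hh : p ^ 2 • h = 0) (hmem : p ^ 2 • g + p • h ∈ S X Y) :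
    redY₁ g = redZ₁ h ∧ redY₂ g = redZ₂ h := by
  obtain ⟨α, β, γ, δ, H⟩ := exists_of_mem_S hmem
  -- The contributions of `u₁` and `u₂` have coefficients divisible by `p ^ 2`.
  have hα : ∀ i, ∃ c, α i = p ^ 2 * c := fun i => by
    have h1 := (H i).1
    have h2 := congrFun (congrArg (fun b => b.1) hg) i
    have h3 := congrFun (congrArg (fun b => b.1) hh) i
    simp at h1 h2 h3
    refine dvd_of_pow_mul_intCast_eq_zero (n := 5) (k := 2) (p := p) ?_
    linear_combination -(p : ZMod (p ^ 7)) ^ 2 * h1 + h2 + p * h3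
  have hβ : ∀ i, ∃ c, β i = p ^ 2 * c := fun i => by
    have h1 := (H i).2.1
    have h2 := congrFun (congrArg (fun b => b.2.1) hg) i
    have h3 := congrFun (congrArg (fun b => b.2.1) hh) i
    simp at h1 h2 h3
    refine dvd_of_pow_mul_intCast_eq_zero (n := 4) (k := 2) (p := p) ?_
    linear_combination -(p : ZMod (p ^ 6)) ^ 2 * h1 + h2 + p * h3
  choose α' hα' using hα
  choose β' hβ' using hβ
  have hs : ∀ (Z : Matrix (Fin m) (Fin m) (ZMod p)) (i : Fin m),
      (∑ j, ((Z i j).val : ℤ) * β j) = p ^ 2 * ∑ j, ((Z i j).val : ℤ) * β' j := fun Z i => by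
    rw [Finset.mul_sum]
    exact Finset.sum_congr rfl fun j _ => by rw [hβ']; ring
  have p4 := natCast_pow_eq_zero (p := p) 4
  have p2 := natCast_pow_eq_zero (p := p) 2
  constructor
  · ext i
    obtain ⟨-, -, h1, -, h2, -⟩ := H i
    rw [hs] at h1 h2
    generalize (∑ j, ((X i j).val : ℤ) * β' j) = s at h1 h2
    have h3 := congrFun (congrArg (fun b => b.2.2.1) hh) i
    simp [hα'] at h1 h2 h3
    trans (γ i : ZMod p)
    · rw [redY₁_eq]
      refine redVec_apply_eq_intCast ?_
      linear_combination (p : ZMod (p ^ 4)) * h1 - h3 + (α' i + s) * p4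
    · symm
      rw [redZ₁_eq]
      refine redVec_apply_eq_intCast ?_
      linear_combination h2 + (s - g.2.2.2.2.1 i) * p2
  · ext i
    obtain ⟨-, -, -, h1, -, h2⟩ := H i
    rw [hs] at h1 h2
    generalize (∑ j, ((Y i j).val : ℤ) * β' j) = s at h1 h2
    have h3 := congrFun (congrArg (fun b => b.2.2.2.1) hh) i
    simp [hα', hβ'] at h1 h2 h3
    trans (δ i : ZMod p)
    · rw [redY₂_eq]
      refine redVec_apply_eq_intCast ?_
      linear_combination (p : ZMod (p ^ 4)) * h1 - h3 + (α' i + β' i + s) * p4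
    · symm
      rw [redZ₂_eq]
      refine redVec_apply_eq_intCast ?_
      linear_combination h2 + (α' i + s - g.2.2.2.2.2 i) * p2

end Subgroup

end RS

/-! ### Morphisms of the embeddings -/

namespace RS

section Sums

variable {M ι : Type*} [AddCommGroup M] [Fintype ι]

theorem add_sum_smul_add (q : ℕ) (c d : ι → ℕ) (s a : M) (y y' z z' : ι → M) :
    s + q • a + ∑ i, c i • (q • y i + z i) + ∑ i, d i • (q • y' i + z' i) =
      s + q • (a + ∑ i, c i • y i + ∑ i, d i • y' i) +
        (∑ i, c i • z i + ∑ i, d i • z' i) := by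
  have h : ∀ (c : ι → ℕ) (y z : ι → M), ∑ i, c i • (q • y i + z i) =
      q • ∑ i, c i • y i + ∑ i, c i • z i := fun c y z => by
    rw [Finset.smul_sum, ← Finset.sum_add_distrib]
    exact Finset.sum_congr rfl fun i _ => by rw [smul_add, smul_comm]
  rw [h, h, smul_add, smul_add]
  abel

theorem smul_sum_eq_zero {q : ℕ} (c : ι → ℕ) {y : ι → M} (h : ∀ i, q • y i = 0) :
    q • ∑ i, c i • y i = 0 := by
  rw [Finset.smul_sum]
  exact Finset.sum_eq_zero fun i _ => by rw [smul_comm, h, smul_zero]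

end Sums

section Morphism

variable {p m : ℕ}

/-- The matrix over `ZMod p` by which an endomorphism of the ambient group acts on the
generators `x₁` of largest order, modulo `p` and the other generators. -/
def topMatrix (f : Ambient p m →+ Ambient p m) : Matrix (Fin m) (Fin m) (ZMod p) :=
  Matrix.of fun i j => redX₁ (f (x₁ j)) i

theorem pow_seven_smul (b : Ambient p m) : p ^ 7 • b = 0 := by
  have h : ∀ k ≤ 7, ∀ v : Fin m → ZMod (p ^ k), p ^ 7 • v = 0 := fun k hk v =>
    pow_smul_eq_zero_of_le hk (by ext i; simp)
  exact Prod.ext (h 7 le_rfl _) (Prod.ext (h 6 (by norm_num) _) (Prod.ext (h 4 (by norm_num) _)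
    (Prod.ext (h 4 (by norm_num) _) (Prod.ext (h 2 (by norm_num) _) (h 2 (by norm_num) _)))))

variable [Fact p.Prime]

theorem redX₁_map (f : Ambient p m →+ Ambient p m) (b : Ambient p m) :
    redX₁ (f b) = (topMatrix f).mulVec (redX₁ b) := by
  have h := map_eq_sum (redX₁.comp f) b
  have h2 : ∀ j, redX₁ (f (x₂ j)) = 0 := fun j =>
    redX₁_eq_zero (pow_smul_map f (pow_smul_x₂ j))
  have h3 : ∀ j, redX₁ (f (y₁ j)) = 0 := fun j =>
    redX₁_eq_zero (pow_smul_map f (pow_smul_eq_zero_of_le (by norm_num) (pow_smul_y₁ j)))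
  have h4 : ∀ j, redX₁ (f (y₂ j)) = 0 := fun j =>
    redX₁_eq_zero (pow_smul_map f (pow_smul_eq_zero_of_le (by norm_num) (pow_smul_y₂ j)))
  have h5 : ∀ j, redX₁ (f (z₁ j)) = 0 := fun j =>
    redX₁_eq_zero (pow_smul_map f (pow_smul_eq_zero_of_le (by norm_num) (pow_smul_z₁ j)))
  have h6 : ∀ j, redX₁ (f (z₂ j)) = 0 := fun j =>
    redX₁_eq_zero (pow_smul_map f (pow_smul_eq_zero_of_le (by norm_num) (pow_smul_z₂ j)))
  simp only [AddMonoidHom.comp_apply, h2, h3, h4, h5, h6, smul_zero, add_zero] at h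
  rw [h]
  ext i
  simp [Matrix.mulVec, dotProduct, topMatrix, mul_comm]

theorem topMatrix_comp (g f : Ambient p m →+ Ambient p m) :
    topMatrix (g.comp f) = topMatrix g * topMatrix f := by
  ext i j
  rw [topMatrix, Matrix.of_apply, AddMonoidHom.comp_apply, redX₁_map]
  rfl

theorem topMatrix_id : topMatrix (AddMonoidHom.id (Ambient p m)) = 1 := by
  ext i j
  simp [topMatrix, redX₁_eq, redVec_apply, x₁, Matrix.one_apply, Pi.single_apply, apply_ite]

theorem topMatrix_sub (g f : Ambient p m →+ Ambient p m) :
    topMatrix (g - f) = topMatrix g - topMatrix f := by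
  ext i j
  simp [topMatrix]

/-- The constraints on a morphism from the embedding of `(X, Y)` to the embedding of `(X', Y')`:
modulo `p`, the diagonal blocks all agree, and their common value intertwines the two pairs. -/
theorem morphism_constraints {X Y X' Y' : Matrix (Fin m) (Fin m) (ZMod p)}
    (f : Ambient p m →+ Ambient p m) (hf : ∀ a ∈ S X Y, f a ∈ S X' Y') :
    (∀ j, redX₂ (f (x₂ j)) = redX₁ (f (x₁ j)) ∧
      (redY₁ (f (y₁ j)) = redX₁ (f (x₁ j)) ∧ redY₁ (f (y₂ j)) = 0 ∧
        redY₂ (f (y₁ j)) = 0 ∧ redY₂ (f (y₂ j)) = redX₁ (f (x₁ j))) ∧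
      (redZ₁ (f (z₁ j)) = redX₁ (f (x₁ j)) ∧ redZ₁ (f (z₂ j)) = 0 ∧
        redZ₂ (f (z₁ j)) = 0 ∧ redZ₂ (f (z₂ j)) = redX₁ (f (x₁ j)))) ∧
    topMatrix f * X = X' * topMatrix f ∧ topMatrix f * Y = Y' * topMatrix f := by
  -- From the images of `v₁` and `v₂`: the blocks of `y` and of `z` agree.
  have hv₁ : ∀ j, redY₁ (f (y₁ j)) = redZ₁ (f (z₁ j)) ∧ redY₂ (f (y₁ j)) = redZ₂ (f (z₁ j)) := by
    intro j
    refine red_eq_of_add_mem_S (X := X') (Y := Y') (pow_smul_map f (pow_smul_y₁ j))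
      (pow_smul_map f (pow_smul_z₁ j)) ?_
    have h := hf (v₁ j) (AddSubgroup.subset_closure (Or.inl (Or.inr ⟨j, rfl⟩)))
    rwa [v₁, map_add, map_nsmul, map_nsmul] at h
  have hv₂ : ∀ j, redY₁ (f (y₂ j)) = redZ₁ (f (z₂ j)) ∧ redY₂ (f (y₂ j)) = redZ₂ (f (z₂ j)) := by
    intro j
    refine red_eq_of_add_mem_S (X := X') (Y := Y') (pow_smul_map f (pow_smul_y₂ j))
      (pow_smul_map f (pow_smul_z₂ j)) ?_
    have h := hf (v₂ j) (AddSubgroup.subset_closure (Or.inr ⟨j, rfl⟩))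
    rwa [v₂, map_add, map_nsmul, map_nsmul] at h
  -- The image of `u₁` is a combination whose coefficients at `u₂` vanish modulo `p`, by its
  -- `x₂`-coordinates, and whose coefficients at `u₁` are read off from its `x₁`-coordinates.
  have hu₁ : ∀ j, redZ₁ (f (z₂ j)) = 0 ∧ redZ₂ (f (z₂ j)) = redX₁ (f (x₁ j)) ∧
      redY₁ (f (y₁ j)) + redY₁ (f (y₂ j)) = redX₁ (f (x₁ j)) ∧
      redY₂ (f (y₁ j)) + redY₂ (f (y₂ j)) = redX₁ (f (x₁ j)) := by
    intro j
    have h := hf (u₁ j) (AddSubgroup.subset_closure (Or.inl (Or.inl (Or.inl ⟨j, rfl⟩))))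
    have h' : u₁ j = p ^ 2 • (p • x₁ j) + p • (y₁ j + y₂ j) + (z₂ j : Ambient p m) := by
      rw [u₁, smul_smul, ← pow_succ, smul_add]
      abel
    rw [h', map_add, map_add, map_nsmul, map_nsmul, map_nsmul] at h
    have hg : p ^ 4 • (y₁ j + y₂ j : Ambient p m) = 0 := by
      rw [smul_add, pow_smul_y₁, pow_smul_y₂, add_zero]
    obtain ⟨α, β, h1, h2, h3, h4, h5, h6⟩ := exists_of_add_mem_S (pow_smul_map f hg)
      (pow_smul_map f (pow_smul_z₂ j)) h
    have hβ : β = 0 := by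
      rw [← h2, map_nsmul]
      ext i
      simp
    have hα : α = redX₁ (f (x₁ j)) := (h1 _ rfl).symm
    subst hβ hα
    rw [Matrix.mulVec_zero, add_zero, map_add, map_add] at h3
    rw [Matrix.mulVec_zero, add_zero, add_zero, map_add, map_add] at h4
    rw [Matrix.mulVec_zero] at h5
    rw [Matrix.mulVec_zero, add_zero] at h6
    exact ⟨h5, h6, h3, h4⟩
  have hdiag : ∀ j, (redY₁ (f (y₁ j)) = redX₁ (f (x₁ j)) ∧ redY₁ (f (y₂ j)) = 0 ∧
        redY₂ (f (y₁ j)) = 0 ∧ redY₂ (f (y₂ j)) = redX₁ (f (x₁ j))) ∧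
      (redZ₁ (f (z₁ j)) = redX₁ (f (x₁ j)) ∧ redZ₁ (f (z₂ j)) = 0 ∧
        redZ₂ (f (z₁ j)) = 0 ∧ redZ₂ (f (z₂ j)) = redX₁ (f (x₁ j))) := by
    intro j
    obtain ⟨a1, a2⟩ := hv₁ j
    obtain ⟨b1, b2⟩ := hv₂ j
    obtain ⟨c1, c2, c3, c4⟩ := hu₁ j
    rw [b1, c1, add_zero] at c3
    rw [b2, c2, add_eq_right] at c4
    exact ⟨⟨c3, b1.trans c1, c4, b2.trans c2⟩, a1 ▸ c3, c1, a2 ▸ c4, c2⟩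
  -- For the image of `u₂`, comparing the coordinates at `y₁` and `z₁` shows that the
  -- coefficients `α` at `u₁` vanish, and comparing those at `y₂` and `z₂` identifies the
  -- coefficients `β` at `u₂`.
  have hu₂ : ∀ j, redX₂ (f (x₂ j)) = redX₁ (f (x₁ j)) ∧
      ∑ i, X i j • redX₁ (f (x₁ i)) = X'.mulVec (redX₁ (f (x₁ j))) ∧
      ∑ i, Y i j • redX₁ (f (x₁ i)) = Y'.mulVec (redX₁ (f (x₁ j))) := by
    intro j
    have h := hf (u₂ X Y j) (AddSubgroup.subset_closure (Or.inl (Or.inl (Or.inr ⟨j, rfl⟩))))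
    have h' : u₂ X Y j = p ^ 2 • x₂ j +
        p • (y₂ j + ∑ i, (X i j).val • y₁ i + ∑ i, (Y i j).val • y₂ i) +
        (∑ i, (X i j).val • z₁ i + ∑ i, (Y i j).val • z₂ i) := by
      rw [u₂, add_sum_smul_add]
    have hg : p ^ 4 • (y₂ j + ∑ i, (X i j).val • y₁ i + ∑ i, (Y i j).val • y₂ i :
        Ambient p m) = 0 := by
      rw [smul_add, smul_add, pow_smul_y₂, smul_sum_eq_zero _ pow_smul_y₁,
        smul_sum_eq_zero _ pow_smul_y₂, add_zero, add_zero]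
    have hh : p ^ 2 • (∑ i, (X i j).val • z₁ i + ∑ i, (Y i j).val • z₂ i :
        Ambient p m) = 0 := by
      rw [smul_add, smul_sum_eq_zero _ pow_smul_z₁, smul_sum_eq_zero _ pow_smul_z₂, add_zero]
    rw [h', map_add, map_add, map_nsmul, map_nsmul] at h
    obtain ⟨α, β, -, h2, h3, h4, h5, h6⟩ := exists_of_add_mem_S
      (pow_smul_map f hg) (pow_smul_map f hh) h
    simp only [map_add, map_sum, map_nsmul, val_smul_eq, hdiag, smul_zero,
      Finset.sum_const_zero, add_zero, zero_add] at h3 h4 h5 h6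
    have hα : α = 0 := by rwa [h5, right_eq_add] at h3
    subst hα
    rw [zero_add] at h4 h6
    have hβ : redX₁ (f (x₁ j)) = β := by rwa [h6, add_left_inj] at h4
    subst hβ
    exact ⟨h2, h5, h6⟩
  refine ⟨fun j => ⟨(hu₂ j).1, hdiag j⟩, ?_, ?_⟩
  · ext i j
    have h := congrFun (hu₂ j).2.1 i
    simpa [topMatrix, Matrix.mul_apply, Matrix.mulVec, dotProduct, mul_comm] using h
  · ext i j
    have h := congrFun (hu₂ j).2.2 i
    simpa [topMatrix, Matrix.mul_apply, Matrix.mulVec, dotProduct, mul_comm] using h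

theorem exists_eq_smul_of_redVec_eq_zero {n : ℕ} {v : Fin m → ZMod (p ^ (n + 1))}
    (h : redVec p m n v = 0) : ∃ w, v = p • w := by
  have h1 : ∀ i, ∃ c, v i = p * c := by
    intro i
    obtain ⟨k, hk⟩ := ZMod.intCast_surjective (v i)
    have h2 := congrFun h i
    rw [redVec_apply, ← hk, map_intCast, Pi.zero_apply, ZMod.intCast_zmod_eq_zero_iff_dvd] at h2
    obtain ⟨c, rfl⟩ := h2
    exact ⟨c, by rw [← hk]; push_cast; rfl⟩
  choose w hw using h1
  exact ⟨w, funext fun i => by rw [hw, Pi.smul_apply, nsmul_eq_mul]⟩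

theorem exists_eq_smul_of_red_eq_zero {b : Ambient p m} (h1 : redX₁ b = 0) (h2 : redX₂ b = 0)
    (h3 : redY₁ b = 0) (h4 : redY₂ b = 0) (h5 : redZ₁ b = 0) (h6 : redZ₂ b = 0) :
    ∃ c, b = p • c := by
  obtain ⟨w1, e1⟩ := exists_eq_smul_of_redVec_eq_zero h1
  obtain ⟨w2, e2⟩ := exists_eq_smul_of_redVec_eq_zero h2
  obtain ⟨w3, e3⟩ := exists_eq_smul_of_redVec_eq_zero h3
  obtain ⟨w4, e4⟩ := exists_eq_smul_of_redVec_eq_zero h4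
  obtain ⟨w5, e5⟩ := exists_eq_smul_of_redVec_eq_zero h5
  obtain ⟨w6, e6⟩ := exists_eq_smul_of_redVec_eq_zero h6
  exact ⟨(w1, w2, w3, w4, w5, w6), Prod.ext e1 (Prod.ext e2 (Prod.ext e3 (Prod.ext e4
    (Prod.ext e5 e6))))⟩

/-- An idempotent endomorphism of the embedding that is zero on the generators `x₁` modulo `p`
is zero: modulo `p`, it is strictly triangular with respect to the orders of the generators. -/
theorem eq_zero_of_topMatrix_eq_zero {X Y : Matrix (Fin m) (Fin m) (ZMod p)}
    (f : Ambient p m →+ Ambient p m) (hf : ∀ a ∈ S X Y, f a ∈ S X Y) (hff : ∀ b, f (f b) = f b)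
    (h0 : topMatrix f = 0) (b : Ambient p m) : f b = 0 := by
  have hc : ∀ j, redX₁ (f (x₁ j)) = 0 := fun j => by
    ext i
    exact congrFun (congrFun h0 i) j
  have hd := (morphism_constraints f hf).1
  simp only [hc] at hd
  have h1 : ∀ b, redX₁ (f b) = 0 := fun b => by rw [redX₁_map, h0, Matrix.zero_mulVec]
  have h2 : ∀ b, redX₂ (f b) = 0 := fun b => by
    have h := map_eq_sum (redX₂.comp f) (f b)
    have e3 : ∀ j, redX₂ (f (y₁ j)) = 0 := fun j =>
      redX₂_eq_zero (pow_smul_map f (pow_smul_eq_zero_of_le (by norm_num) (pow_smul_y₁ j)))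
    have e4 : ∀ j, redX₂ (f (y₂ j)) = 0 := fun j =>
      redX₂_eq_zero (pow_smul_map f (pow_smul_eq_zero_of_le (by norm_num) (pow_smul_y₂ j)))
    have e5 : ∀ j, redX₂ (f (z₁ j)) = 0 := fun j =>
      redX₂_eq_zero (pow_smul_map f (pow_smul_eq_zero_of_le (by norm_num) (pow_smul_z₁ j)))
    have e6 : ∀ j, redX₂ (f (z₂ j)) = 0 := fun j =>
      redX₂_eq_zero (pow_smul_map f (pow_smul_eq_zero_of_le (by norm_num) (pow_smul_z₂ j)))
    simpa [h1, hd, hff, e3, e4, e5, e6] using h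
  have h3 : ∀ b, redY₁ (f b) = 0 := fun b => by
    have h := map_eq_sum (redY₁.comp f) (f b)
    have e5 : ∀ j, redY₁ (f (z₁ j)) = 0 := fun j =>
      redY₁_eq_zero (pow_smul_map f (pow_smul_eq_zero_of_le (by norm_num) (pow_smul_z₁ j)))
    have e6 : ∀ j, redY₁ (f (z₂ j)) = 0 := fun j =>
      redY₁_eq_zero (pow_smul_map f (pow_smul_eq_zero_of_le (by norm_num) (pow_smul_z₂ j)))
    simpa [h1, h2, hd, hff, e5, e6] using h
  have h4 : ∀ b, redY₂ (f b) = 0 := fun b => by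
    have h := map_eq_sum (redY₂.comp f) (f b)
    have e5 : ∀ j, redY₂ (f (z₁ j)) = 0 := fun j =>
      redY₂_eq_zero (pow_smul_map f (pow_smul_eq_zero_of_le (by norm_num) (pow_smul_z₁ j)))
    have e6 : ∀ j, redY₂ (f (z₂ j)) = 0 := fun j =>
      redY₂_eq_zero (pow_smul_map f (pow_smul_eq_zero_of_le (by norm_num) (pow_smul_z₂ j)))
    simpa [h1, h2, hd, hff, e5, e6] using h
  have h5 : ∀ b, redZ₁ (f b) = 0 := fun b => by
    have h := map_eq_sum (redZ₁.comp f) (f b)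
    simpa [h1, h2, h3, h4, hd, hff] using h
  have h6 : ∀ b, redZ₂ (f b) = 0 := fun b => by
    have h := map_eq_sum (redZ₂.comp f) (f b)
    simpa [h1, h2, h3, h4, hd, hff] using h
  have key : ∀ n : ℕ, ∃ c, f b = p ^ n • c := by
    intro n
    induction n with
    | zero => exact ⟨f b, by simp⟩
    | succ n ih =>
      obtain ⟨c, hcn⟩ := ih
      obtain ⟨c', hc'⟩ := exists_eq_smul_of_red_eq_zero (h1 c) (h2 c) (h3 c) (h4 c) (h5 c) (h6 c)
      refine ⟨c', ?_⟩
      rw [← hff, hcn, map_nsmul, hc', smul_smul, ← pow_succ]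
  obtain ⟨c, hc7⟩ := key 7
  rw [hc7, pow_seven_smul]

end Morphism

end RS

/-! ### Lifting matrices to the ambient group -/

namespace RS

section Lift

variable {p m : ℕ}

/-- The action of a matrix over `ZMod (p ^ 7)` on vectors over `ZMod (p ^ k)`, for `k ≤ 7`. -/
def matAct {k : ℕ} (hk : k ≤ 7) (M : Matrix (Fin m) (Fin m) (ZMod (p ^ 7))) :
    (Fin m → ZMod (p ^ k)) →+ (Fin m → ZMod (p ^ k)) :=
  (M.map (ZMod.castHom (pow_dvd_pow p hk) (ZMod (p ^ k)))).mulVecLin.toAddMonoidHom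

theorem matAct_apply {k : ℕ} (hk : k ≤ 7) (M : Matrix (Fin m) (Fin m) (ZMod (p ^ 7)))
    (v : Fin m → ZMod (p ^ k)) :
    matAct hk M v = (M.map (ZMod.castHom (pow_dvd_pow p hk) (ZMod (p ^ k)))).mulVec v :=
  rfl

theorem matAct_matAct {k : ℕ} (hk : k ≤ 7) {M N : Matrix (Fin m) (Fin m) (ZMod (p ^ 7))}
    (h : M * N = 1) (v : Fin m → ZMod (p ^ k)) : matAct hk M (matAct hk N v) = v := by
  rw [matAct_apply, matAct_apply, Matrix.mulVec_mulVec, ← Matrix.map_mul, h,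
    Matrix.map_one _ (map_zero _) (map_one _), Matrix.one_mulVec]

theorem matAct_single {k : ℕ} [NeZero p] (hk : k ≤ 7) (M : Matrix (Fin m) (Fin m) (ZMod (p ^ 7)))
    (j : Fin m) : matAct hk M (Pi.single j 1) = ∑ i, (M i j).val • Pi.single i 1 := by
  ext i
  rw [matAct_apply, Matrix.mulVec_single_one, Finset.sum_apply, Finset.sum_eq_single i]
  · rw [Pi.smul_apply, Pi.single_eq_same, nsmul_one, Matrix.col_apply, Matrix.map_apply,
      ← map_natCast (ZMod.castHom (pow_dvd_pow p hk) (ZMod (p ^ k))), ZMod.natCast_zmod_val]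
  · intro i' _ h
    rw [Pi.smul_apply, Pi.single_eq_of_ne h.symm, smul_zero]
  · simp

/-- The action of a matrix over `ZMod (p ^ 7)` on the ambient group, the same on each of the six
types of generators. -/
def act (M : Matrix (Fin m) (Fin m) (ZMod (p ^ 7))) : Ambient p m →+ Ambient p m :=
  (matAct (by norm_num) M).prodMap ((matAct (by norm_num) M).prodMap
    ((matAct (by norm_num) M).prodMap ((matAct (by norm_num) M).prodMap
      ((matAct (by norm_num) M).prodMap (matAct (by norm_num) M)))))

theorem act_mk (M : Matrix (Fin m) (Fin m) (ZMod (p ^ 7))) (b : Ambient p m) :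
    act M b = (matAct (by norm_num) M b.1, matAct (by norm_num) M b.2.1,
      matAct (by norm_num) M b.2.2.1, matAct (by norm_num) M b.2.2.2.1,
      matAct (by norm_num) M b.2.2.2.2.1, matAct (by norm_num) M b.2.2.2.2.2) :=
  rfl

theorem act_act {M N : Matrix (Fin m) (Fin m) (ZMod (p ^ 7))} (h : M * N = 1) (b : Ambient p m) :
    act M (act N b) = b := by
  simp only [act_mk, matAct_matAct _ h]

variable [NeZero p] (M : Matrix (Fin m) (Fin m) (ZMod (p ^ 7))) (j : Fin m)

theorem act_x₁ : act M (x₁ j) = ∑ i, (M i j).val • x₁ i := by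
  refine Prod.ext ?_ (Prod.ext ?_ (Prod.ext ?_ (Prod.ext ?_ (Prod.ext ?_ ?_)))) <;>
    simp only [act_mk, x₁, matAct_single, map_zero, Prod.fst_sum, Prod.snd_sum, Prod.smul_mk,
      smul_zero, Finset.sum_const_zero]
theorem act_x₂ : act M (x₂ j) = ∑ i, (M i j).val • x₂ i := by
  refine Prod.ext ?_ (Prod.ext ?_ (Prod.ext ?_ (Prod.ext ?_ (Prod.ext ?_ ?_)))) <;>
    simp only [act_mk, x₂, matAct_single, map_zero, Prod.fst_sum, Prod.snd_sum, Prod.smul_mk,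
      smul_zero, Finset.sum_const_zero]
theorem act_y₁ : act M (y₁ j) = ∑ i, (M i j).val • y₁ i := by
  refine Prod.ext ?_ (Prod.ext ?_ (Prod.ext ?_ (Prod.ext ?_ (Prod.ext ?_ ?_)))) <;>
    simp only [act_mk, y₁, matAct_single, map_zero, Prod.fst_sum, Prod.snd_sum, Prod.smul_mk,
      smul_zero, Finset.sum_const_zero]
theorem act_y₂ : act M (y₂ j) = ∑ i, (M i j).val • y₂ i := by
  refine Prod.ext ?_ (Prod.ext ?_ (Prod.ext ?_ (Prod.ext ?_ (Prod.ext ?_ ?_)))) <;>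
    simp only [act_mk, y₂, matAct_single, map_zero, Prod.fst_sum, Prod.snd_sum, Prod.smul_mk,
      smul_zero, Finset.sum_const_zero]
theorem act_z₁ : act M (z₁ j) = ∑ i, (M i j).val • z₁ i := by
  refine Prod.ext ?_ (Prod.ext ?_ (Prod.ext ?_ (Prod.ext ?_ (Prod.ext ?_ ?_)))) <;>
    simp only [act_mk, z₁, matAct_single, map_zero, Prod.fst_sum, Prod.snd_sum, Prod.smul_mk,
      smul_zero, Finset.sum_const_zero]
theorem act_z₂ : act M (z₂ j) = ∑ i, (M i j).val • z₂ i := by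
  refine Prod.ext ?_ (Prod.ext ?_ (Prod.ext ?_ (Prod.ext ?_ (Prod.ext ?_ ?_)))) <;>
    simp only [act_mk, z₂, matAct_single, map_zero, Prod.fst_sum, Prod.snd_sum, Prod.smul_mk,
      smul_zero, Finset.sum_const_zero]

end Lift

section Sums

variable {B ι : Type*} [AddCommGroup B] [Fintype ι]

theorem smul_sum_smul (q : ℕ) (c : ι → ℕ) (y : ι → B) :
    q • ∑ i, c i • y i = ∑ i, c i • q • y i := by
  rw [Finset.smul_sum]
  exact Finset.sum_congr rfl fun i _ => smul_comm _ _ _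

theorem sum_smul_sum_smul (c : ι → ℕ) (d : ι → ι → ℕ) (w : ι → B) :
    ∑ k, c k • ∑ i, d i k • w i = ∑ i, (∑ k, d i k * c k) • w i := by
  simp only [Finset.smul_sum, Finset.sum_smul]
  rw [Finset.sum_comm]
  refine Finset.sum_congr rfl fun i _ => Finset.sum_congr rfl fun k _ => ?_
  rw [smul_smul, mul_comm]

theorem sum_smul_sub_sum_smul_mem {p : ℕ} {A : AddSubgroup B} {w : ι → B}
    (hw : ∀ i, p • w i ∈ A) {c d : ι → ℕ} (h : ∀ i, (c i : ZMod p) = d i) :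
    ∑ i, c i • w i - ∑ i, d i • w i ∈ A := by
  rw [← Finset.sum_sub_distrib]
  refine A.sum_mem fun i _ => ?_
  have h1 : ((c i - d i : ℤ) : ZMod p) = 0 := by
    push_cast
    rw [h, sub_self]
  rw [ZMod.intCast_zmod_eq_zero_iff_dvd] at h1
  obtain ⟨k, hk⟩ := h1
  have h2 : c i • w i - d i • w i = k • p • w i := by
    rw [← natCast_zsmul, ← natCast_zsmul, ← natCast_zsmul, ← sub_smul, hk, smul_smul, mul_comm]
  rw [h2]
  exact A.zsmul_mem (hw i) k

end Sums

section LiftMem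

variable {p m : ℕ} [Fact p.Prime]

/-- A lift of a matrix that intertwines the pairs `(X, Y)` and `(X', Y')` is a morphism of the
embeddings. -/
theorem act_mem_S {X Y X' Y' P : Matrix (Fin m) (Fin m) (ZMod p)}
    {M : Matrix (Fin m) (Fin m) (ZMod (p ^ 7))} (hM : ∀ i j, ((M i j).val : ZMod p) = P i j)
    (hX : P * X = X' * P) (hY : P * Y = Y' * P) {a : Ambient p m} (ha : a ∈ S X Y) :
    act M a ∈ S X' Y' := by
  have hu₁ : ∀ i, u₁ i ∈ S X' Y' := fun i =>
    AddSubgroup.subset_closure (Or.inl (Or.inl (Or.inl ⟨i, rfl⟩)))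
  have hu₂ : ∀ i, u₂ X' Y' i ∈ S X' Y' := fun i =>
    AddSubgroup.subset_closure (Or.inl (Or.inl (Or.inr ⟨i, rfl⟩)))
  have hv₁ : ∀ i, v₁ i ∈ S X' Y' := fun i =>
    AddSubgroup.subset_closure (Or.inl (Or.inr ⟨i, rfl⟩))
  have hv₂ : ∀ i, v₂ i ∈ S X' Y' := fun i =>
    AddSubgroup.subset_closure (Or.inr ⟨i, rfl⟩)
  suffices h : S X Y ≤ (S X' Y').comap (act M) from h ha
  rw [S, AddSubgroup.closure_le]
  -- Only `u₂` is not mapped to the combination that the lift suggests: there the intertwining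
  -- relations hold modulo `p` only, and the error is a combination of the `v₁` and `v₂`.
  rintro _ (((⟨j, rfl⟩ | ⟨j, rfl⟩) | ⟨j, rfl⟩) | ⟨j, rfl⟩)
  · have h : act M (u₁ j) = ∑ i, (M i j).val • u₁ i := by
      simp only [u₁, map_add, map_nsmul, act_x₁, act_y₁, act_y₂, act_z₂, smul_sum_smul, smul_add,
        Finset.sum_add_distrib]
    change act M (u₁ j) ∈ S X' Y'
    rw [h]
    exact sum_mem fun i _ => AddSubgroup.nsmul_mem _ (hu₁ i) _
  · have hw₁ : ∀ k, act M (p • y₁ k + z₁ k) = ∑ i, (M i k).val • (p • y₁ i + z₁ i) := fun k => by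
      simp only [map_add, map_nsmul, act_y₁, act_z₁, smul_sum_smul, smul_add,
        Finset.sum_add_distrib]
    have hw₂ : ∀ k, act M (p • y₂ k + z₂ k) = ∑ i, (M i k).val • (p • y₂ i + z₂ i) := fun k => by
      simp only [map_add, map_nsmul, act_y₂, act_z₂, smul_sum_smul, smul_add,
        Finset.sum_add_distrib]
    have hpw₁ : ∀ i, p • (p • y₁ i + z₁ i) ∈ S X' Y' := fun i => by
      rw [smul_add, smul_smul, ← sq]
      exact hv₁ i
    have hpw₂ : ∀ i, p • (p • y₂ i + z₂ i) ∈ S X' Y' := fun i => by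
      rw [smul_add, smul_smul, ← sq]
      exact hv₂ i
    have h : act M (u₂ X Y j) - ∑ i, (M i j).val • u₂ X' Y' i =
        (∑ i, (∑ k, (M i k).val * (X k j).val) • (p • y₁ i + z₁ i) -
          ∑ i, (∑ k, (X' i k).val * (M k j).val) • (p • y₁ i + z₁ i)) +
        (∑ i, (∑ k, (M i k).val * (Y k j).val) • (p • y₂ i + z₂ i) -
          ∑ i, (∑ k, (Y' i k).val * (M k j).val) • (p • y₂ i + z₂ i)) := by
      rw [← sum_smul_sum_smul, ← sum_smul_sum_smul, ← sum_smul_sum_smul, ← sum_smul_sum_smul]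
      have h1 : act M (u₂ X Y j) = ∑ i, (M i j).val • p ^ 2 • x₂ i +
          ∑ i, (M i j).val • p • y₂ i +
          ∑ k, (X k j).val • ∑ i, (M i k).val • (p • y₁ i + z₁ i) +
          ∑ k, (Y k j).val • ∑ i, (M i k).val • (p • y₂ i + z₂ i) := by
        rw [u₂, map_add, map_add, map_add, map_nsmul, map_nsmul, act_x₂, act_y₂, map_sum, map_sum]
        simp only [map_nsmul, hw₁, hw₂]
        rw [smul_sum_smul, smul_sum_smul]
      have h2 : ∑ i, (M i j).val • u₂ X' Y' i = ∑ i, (M i j).val • p ^ 2 • x₂ i +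
          ∑ i, (M i j).val • p • y₂ i +
          ∑ k, (M k j).val • ∑ i, (X' i k).val • (p • y₁ i + z₁ i) +
          ∑ k, (M k j).val • ∑ i, (Y' i k).val • (p • y₂ i + z₂ i) := by
        rw [← Finset.sum_add_distrib, ← Finset.sum_add_distrib, ← Finset.sum_add_distrib]
        exact Finset.sum_congr rfl fun i _ => by rw [u₂, smul_add, smul_add, smul_add]
      rw [h1, h2]
      abel
    change act M (u₂ X Y j) ∈ S X' Y'
    rw [sub_eq_iff_eq_add] at h
    rw [h]
    refine add_mem (add_mem (sum_smul_sub_sum_smul_mem hpw₁ fun i => ?_)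
      (sum_smul_sub_sum_smul_mem hpw₂ fun i => ?_))
      (sum_mem fun i _ => AddSubgroup.nsmul_mem _ (hu₂ i) _)
    · have h3 := congrFun (congrFun hX i) j
      push_cast
      simpa [Matrix.mul_apply, hM, -ZMod.natCast_val, ZMod.natCast_zmod_val] using h3
    · have h3 := congrFun (congrFun hY i) j
      push_cast
      simpa [Matrix.mul_apply, hM, -ZMod.natCast_val, ZMod.natCast_zmod_val] using h3
  · have h : act M (v₁ j) = ∑ i, (M i j).val • v₁ i := by
      simp only [v₁, map_add, map_nsmul, act_y₁, act_z₁, smul_sum_smul, smul_add,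
        Finset.sum_add_distrib]
    change act M (v₁ j) ∈ S X' Y'
    rw [h]
    exact sum_mem fun i _ => AddSubgroup.nsmul_mem _ (hv₁ i) _
  · have h : act M (v₂ j) = ∑ i, (M i j).val • v₂ i := by
      simp only [v₂, map_add, map_nsmul, act_y₂, act_z₂, smul_sum_smul, smul_add,
        Finset.sum_add_distrib]
    change act M (v₂ j) ∈ S X' Y'
    rw [h]
    exact sum_mem fun i _ => AddSubgroup.nsmul_mem _ (hv₂ i) _

/-- Inverse matrices over `ZMod p` lift to inverse matrices over `ZMod (p ^ 7)`, since an element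
of `ZMod (p ^ 7)` is a unit when its residue modulo `p` is not zero. -/
theorem exists_lift_inverse {P Q : Matrix (Fin m) (Fin m) (ZMod p)} (hPQ : P * Q = 1) :
    ∃ M N : Matrix (Fin m) (Fin m) (ZMod (p ^ 7)), M * N = 1 ∧ N * M = 1 ∧
      (∀ i j, ((M i j).val : ZMod p) = P i j) ∧ ∀ i j, ((N i j).val : ZMod p) = Q i j := by
  let φ := ZMod.castHom (dvd_pow_self p (by norm_num : 7 ≠ 0)) (ZMod p)
  have hφ : ∀ a : ZMod (p ^ 7), (a.val : ZMod p) = φ a := fun a => by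
    rw [← map_natCast φ, ZMod.natCast_zmod_val]
  let M : Matrix (Fin m) (Fin m) (ZMod (p ^ 7)) := Matrix.of fun i j => ((P i j).val : ZMod (p ^ 7))
  have hM : φ.mapMatrix M = P := by
    ext i j
    change φ ((P i j).val : ZMod (p ^ 7)) = P i j
    rw [map_natCast, ZMod.natCast_zmod_val]
  have hdet : IsUnit M.det := by
    have h1 : φ M.det ≠ 0 := by
      rw [RingHom.map_det, hM]
      intro h0
      have h2 := congrArg Matrix.det hPQ
      rw [Matrix.det_mul, h0, zero_mul, Matrix.det_one] at h2
      exact zero_ne_one h2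
    rw [← hφ, Ne, ZMod.natCast_eq_zero_iff] at h1
    rw [← ZMod.natCast_zmod_val M.det, ZMod.isUnit_iff_coprime]
    exact (((Fact.out : p.Prime).coprime_iff_not_dvd.2 h1).symm).pow_right 7
  refine ⟨M, M⁻¹, Matrix.mul_nonsing_inv M hdet, Matrix.nonsing_inv_mul M hdet, fun i j => ?_,
    fun i j => ?_⟩
  · rw [hφ]
    exact congrFun (congrFun hM i) j
  · have h1 : φ.mapMatrix M⁻¹ * P = 1 := by
      rw [← hM, ← map_mul, Matrix.nonsing_inv_mul M hdet, map_one]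
    have h2 : φ.mapMatrix M⁻¹ = Q := left_inv_eq_right_inv h1 hPQ
    rw [hφ]
    exact congrFun (congrFun h2 i) j

end LiftMem

end RS

/-! ### Idempotent matrices and decompositions of pairs -/

section Idempotent

variable {k : Type*} [Field k] {m : ℕ}

/-- A basis adapted to the decomposition of the space into the range and the kernel of an
idempotent. -/
theorem exists_basis_of_isIdempotentElem {V : Type*} [AddCommGroup V] [Module k V]
    [FiniteDimensional k V] (hV : Module.finrank k V = m) {f : V →ₗ[k] V}
    (hf : IsIdempotentElem f) : ∃ (b : Module.Basis (Fin m) k V) (r : ℕ), ∀ j : Fin m,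
      f (b j) = (if (j : ℕ) < r then (1 : k) else 0) • b j := by
  have hproj : LinearMap.IsProj (LinearMap.range f) f :=
    (LinearMap.isProj_range_iff_isIdempotentElem f).2 hf
  have hcard : Module.finrank k (LinearMap.range f) + Module.finrank k (LinearMap.ker f) = m := by
    rw [LinearMap.finrank_range_add_finrank_ker, hV]
  let b₁ := Module.finBasis k (LinearMap.range f)
  let b₂ := Module.finBasis k (LinearMap.ker f)
  let e := Submodule.prodEquivOfIsCompl _ _ hproj.isCompl
  let σ := finSumFinEquiv.trans (finCongr hcard)
  refine ⟨((b₁.prod b₂).map e).reindex σ, Module.finrank k (LinearMap.range f), fun j => ?_⟩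
  obtain ⟨s, rfl⟩ := σ.surjective j
  rw [Module.Basis.reindex_apply, Equiv.symm_apply_apply, Module.Basis.map_apply]
  rcases s with s | s
  · have h2 : e ((b₁.prod b₂) (Sum.inl s)) = b₁ s := by simp [e]
    have h3 : ((σ (Sum.inl s) : Fin m) : ℕ) < Module.finrank k (LinearMap.range f) := by
      simp [σ]
    rw [if_pos h3, one_smul, h2]
    exact hproj.map_id _ (b₁ s).2
  · have h2 : e ((b₁.prod b₂) (Sum.inr s)) = b₂ s := by simp [e]
    have h3 : ¬ ((σ (Sum.inr s) : Fin m) : ℕ) < Module.finrank k (LinearMap.range f) := by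
      simp [σ]
    rw [if_neg h3, zero_smul, h2]
    exact (b₂ s).2

/-- An idempotent matrix is conjugate to a diagonal matrix with ones followed by zeros. -/
theorem exists_mul_eq_mul_diagonal {P : Matrix (Fin m) (Fin m) k} (hP : P * P = P) :
    ∃ (C : GL (Fin m) k) (r : ℕ), P * (C : Matrix (Fin m) (Fin m) k) =
      C * Matrix.diagonal fun i : Fin m => if (i : ℕ) < r then (1 : k) else 0 := by
  have hf : IsIdempotentElem (Matrix.toLin' P) := by
    rw [IsIdempotentElem, Module.End.mul_eq_comp, ← Matrix.toLin'_mul, hP]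
  obtain ⟨b, r, hb⟩ := exists_basis_of_isIdempotentElem (Module.finrank_fin_fun k) hf
  let c := Pi.basisFun k (Fin m)
  refine ⟨⟨c.toMatrix b, b.toMatrix c, c.toMatrix_mul_toMatrix_flip b,
    b.toMatrix_mul_toMatrix_flip c⟩, r, ?_⟩
  ext i j
  have h := congrFun (hb j) i
  rw [Matrix.mul_diagonal]
  simpa [Matrix.mul_apply, Matrix.mulVec, dotProduct, c, mul_comm, Module.Basis.toMatrix_apply]
    using h

/-- A nontrivial idempotent that commutes with both matrices of a pair decomposes the pair. -/
theorem isDecomposablePair_of_idempotent {X Y P : Matrix (Fin m) (Fin m) k} (hP : P * P = P)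
    (hX : P * X = X * P) (hY : P * Y = Y * P) (h0 : P ≠ 0) (h1 : P ≠ 1) :
    IsDecomposablePair X Y := by
  obtain ⟨C, r, hC⟩ := exists_mul_eq_mul_diagonal hP
  set D : Matrix (Fin m) (Fin m) k :=
    Matrix.diagonal fun i : Fin m => if (i : ℕ) < r then (1 : k) else 0 with hD
  have hP' : P = C * D * (C⁻¹ : GL (Fin m) k) := by
    rw [← hC, mul_assoc, Units.mul_inv, mul_one]
  have hD' : D = (C⁻¹ : GL (Fin m) k) * P * C := by
    rw [mul_assoc, hC, Units.inv_mul_cancel_left]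
  have hcomm : ∀ Z : Matrix (Fin m) (Fin m) k, P * Z = Z * P →
      IsBlockDiagAt r ((↑C⁻¹ : Matrix (Fin m) (Fin m) k) * Z * (C : Matrix (Fin m) (Fin m) k)) := by
    intro Z hZ
    set Z' := (↑C⁻¹ : Matrix (Fin m) (Fin m) k) * Z * (C : Matrix (Fin m) (Fin m) k) with hZ'
    have h2 : D * Z' = Z' * D := by
      rw [hD', hZ']
      simp only [mul_assoc, Units.mul_inv_cancel_left]
      rw [← mul_assoc P, hZ, mul_assoc]
    intro i j hij
    have h3 := congrFun (congrFun h2 i) j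
    rw [hD, Matrix.diagonal_mul, Matrix.mul_diagonal] at h3
    rcases hij with ⟨hi, hj⟩ | ⟨hi, hj⟩
    · rw [if_pos hi, if_neg (not_lt.2 hj), one_mul, mul_zero] at h3
      exact h3
    · rw [if_neg (not_lt.2 hi), if_pos hj, zero_mul, mul_one] at h3
      exact h3.symm
  refine ⟨r, _, _, ?_, ?_, hcomm X hX, hcomm Y hY, C⁻¹, by rw [inv_inv], by rw [inv_inv]⟩
  · by_contra hr
    apply h0
    have h2 : D = 0 := by
      rw [hD, show r = 0 by omega]
      simp
    rw [hP', h2, mul_zero, zero_mul]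
  · by_contra hr
    apply h1
    have h2 : D = 1 := by
      rw [hD, ← Matrix.diagonal_one]
      congr 1
      ext i
      rw [if_pos (by omega)]
    rw [hP', h2, mul_one, Units.mul_inv]

end Idempotent

theorem theorem3 (p : ℕ) [Fact p.Prime] (m : ℕ)
    (X Y X' Y' : Matrix (Fin m) (Fin m) (ZMod p)) :
    (IsMetabelian (MetabelianGroup (RS.S X Y)) ∧
      (m ≠ 0 → ¬ IsDecomposablePair X Y →
        IsIndecomposableGroup (MetabelianGroup (RS.S X Y)))) ∧
    (Nonempty (MetabelianGroup (RS.S X Y) ≃* MetabelianGroup (RS.S X' Y')) ↔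
      SimConj X Y X' Y') := by
  refine ⟨⟨isMetabelian_metabelianGroup _, fun hm hdec => ?_⟩, ?_, ?_⟩
  · have : Fact (1 < p ^ 7) := ⟨Nat.one_lt_pow (by norm_num) (Fact.out : p.Prime).one_lt⟩
    have : Nonempty (Fin m) := ⟨⟨0, Nat.pos_of_ne_zero hm⟩⟩
    refine isIndecomposableGroup_metabelianGroup _ fun f hf hff => ?_
    obtain ⟨-, hX, hY⟩ := RS.morphism_constraints f hf
    have hP : RS.topMatrix f * RS.topMatrix f = RS.topMatrix f := by
      rw [← RS.topMatrix_comp]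
      exact congrArg _ (AddMonoidHom.ext hff)
    by_cases h0 : RS.topMatrix f = 0
    · exact Or.inl (RS.eq_zero_of_topMatrix_eq_zero f hf hff h0)
    by_cases h1 : RS.topMatrix f = 1
    · right
      intro b
      have h2 := RS.eq_zero_of_topMatrix_eq_zero (X := X) (Y := Y)
        (AddMonoidHom.id _ - f) (fun a ha => sub_mem ha (hf a ha))
        (fun b => by simp [hff]) (by rw [RS.topMatrix_sub, RS.topMatrix_id, h1, sub_self]) b
      exact (sub_eq_zero.1 h2).symm
    · exact absurd (isDecomposablePair_of_idempotent hP hX hY h0 h1) hdec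
  · rintro ⟨e⟩
    obtain ⟨f, f', hf'f, hff', hf, -⟩ := exists_addMonoidHom_of_mulEquiv e
    obtain ⟨-, hX, hY⟩ := RS.morphism_constraints f hf
    have h1 : RS.topMatrix f * RS.topMatrix f' = 1 := by
      rw [← RS.topMatrix_comp, ← RS.topMatrix_id]
      exact congrArg _ (AddMonoidHom.ext hff')
    have h2 : RS.topMatrix f' * RS.topMatrix f = 1 := by
      rw [← RS.topMatrix_comp, ← RS.topMatrix_id]
      exact congrArg _ (AddMonoidHom.ext hf'f)
    refine ⟨⟨RS.topMatrix f, RS.topMatrix f', h1, h2⟩, ?_, ?_⟩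
    · change RS.topMatrix f * X * RS.topMatrix f' = X'
      rw [hX, mul_assoc, h1, mul_one]
    · change RS.topMatrix f * Y * RS.topMatrix f' = Y'
      rw [hY, mul_assoc, h1, mul_one]
  · rintro ⟨P, rfl, rfl⟩
    obtain ⟨M, N, hMN, hNM, hM, hN⟩ := RS.exists_lift_inverse P.mul_inv
    refine nonempty_mulEquiv_of_addEquiv
      { RS.act M with
        invFun := RS.act N
        left_inv := RS.act_act hNM
        right_inv := RS.act_act hMN } (fun a ha => RS.act_mem_S hM ?_ ?_ ha)
      (fun a ha => RS.act_mem_S hN ?_ ?_ ha) <;>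
    simp [mul_assoc]
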